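/- Let $d$ be a natural number and let $\mathbb H^d=\mathbb R^d\times\mathbb R^d\times\mathbb R$ be the Heisenberg group with law $(p,q,t)(p',q',t')=(p+p',q+q',t+t'+p\cdot q')$ and with Lebesgue measure as Haar measure. For $\lambda\in\mathbb R\setminus\{0\}$ let $\pi_\lambda$ be the Schrödinger representation on $L^2(\mathbb R^d)$, $\pi_\lambda(p,q,t)f(y)=e^{2\pi i\lambda t}e^{-2\pi i\lambda q\cdot y}f(y-p)$. Let $\mathcal F$ be the group Fourier transform on $L^2(\mathbb H^d)$, that is, the closure, from $L^2(\mathbb H^d)$ to $L^2(\mathbb R^*,\mathcal{HS}(L^2(\mathbb R^d)),|\lambda|^d\,d\lambda)$ (where $\mathcal{HS}$ denotes the Hilbert–Schmidt operators), of the map $\varphi\mapsto\big(\lambda\mapsto\int_{\mathbb H^d}\varphi(x)\pi_\lambda(x)\,dx\big)$ on $L^1(\mathbb H^d)\cap L^2(\mathbb H^d)$. Let $A,B\in GL(d,\mathbb R)$ be such that $A^tB$ has integer entries, so that $\Gamma=A\mathbb Z^d\times B\mathbb Z^d\times\mathbb Z$ is a subgroup of $\mathbb H^d$, and let $\Gamma_1=A\mathbb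 Z^d\times B\mathbb Z^d$, identified with the set of all $(p,q,0)\in\mathbb H^d$ with $p\in A\mathbb Z^d$, $q\in B\mathbb Z^d$. For $g\in\mathbb H^d$ let $L_g\psi(x)=\psi(g^{-1}x)$ for $\psi\in L^2(\mathbb H^d)$. Let $u\in L^2(\mathbb R^d)$ with $\|u\|=1$, let $u_\lambda(x)=|\lambda|^{d/2}u(\lambda x)$ for $\lambda\neq0$, and let $\mathbb P_\lambda f=\langle f,u_\lambda\rangle u_\lambda$ be the rank-one projection onto $u_\lambda$. Let $\varepsilon\in(0,1)$ and put $H_\varepsilon(\lambda)=\mathbb P_\lambda$ for $\varepsilon<\lambda\le1$ and $H_\varepsilon(\lambda)=0$ for all other $\lambda$. Then there is exactly one $\psi_\varepsilon\in L^2(\mathbb H^d)$ with $\mathcal F\psi_\varepsilon=H_\varepsilon$. If moreover $\{\pi_\alpha(\gamma_1)u_\alpha\}_{\gamma_1\in\Gamma_1}$ is an orthonormal system in $L^2(\mathbb R^d)$ for almost every $\alpha\in(\varepsilon,1]$, then $\{L_\gamma\psi_\varepsilon\}_{\gamma\in\Gamma}$ is a frame for its closed linear span $V$ in $L^2(\mathbb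 H^d)$: there are constants $0<a\le b<\infty$ such that $$a\|\varphi\|^2\le\sum_{\gamma\in\Gamma}|\langle\varphi,L_\gamma\psi_\varepsilon\rangle|^2\le b\|\varphi\|^2\qquad\text{for all }\varphi\in V.$$ -/

import Mathlib

open MeasureTheory Filter Topology
open scoped ENNReal

noncomputable section

namespace HeisFrame

/-! ### The (polarized) Heisenberg group -/

/-- `ℝ^d` with its Euclidean structure and Lebesgue measure. -/
abbrev Rd (d : ℕ) : Type := EuclideanSpace ℝ (Fin d)

/-- The Heisenberg group `ℍ^d = ℝ^d × ℝ^d × ℝ`; its elements are triples `(p, q, t)`. -/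
def Heis (d : ℕ) : Type := Rd d × Rd d × ℝ

namespace Heis

variable {d : ℕ}

instance : TopologicalSpace (Heis d) := inferInstanceAs (TopologicalSpace (Rd d × Rd d × ℝ))
instance : SecondCountableTopology (Heis d) :=
  inferInstanceAs (SecondCountableTopology (Rd d × Rd d × ℝ))
instance : MeasurableSpace (Heis d) := inferInstanceAs (MeasurableSpace (Rd d × Rd d × ℝ))
instance : BorelSpace (Heis d) := inferInstanceAs (BorelSpace (Rd d × Rd d × ℝ))

/-- The Haar measure of `ℍ^d` is the Lebesgue measure of `ℝ^{2d+1}`. -/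
instance : MeasureSpace (Heis d) := inferInstanceAs (MeasureSpace (Rd d × Rd d × ℝ))

/-- The element `(p, q, t)`. -/
def mk (p q : Rd d) (t : ℝ) : Heis d := (p, q, t)

/-- The first component of `(p, q, t)`. -/
def p (x : Heis d) : Rd d := (show Rd d × Rd d × ℝ from x).1

/-- The second component of `(p, q, t)`. -/
def q (x : Heis d) : Rd d := (show Rd d × Rd d × ℝ from x).2.1

/-- The third, central component of `(p, q, t)`. -/
def t (x : Heis d) : ℝ := (show Rd d × Rd d × ℝ from x).2.2

@[simp] theorem p_mk (a b : Rd d) (c : ℝ) : (mk a b c).p = a := rfl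
@[simp] theorem q_mk (a b : Rd d) (c : ℝ) : (mk a b c).q = b := rfl
@[simp] theorem t_mk (a b : Rd d) (c : ℝ) : (mk a b c).t = c := rfl

theorem ext {x y : Heis d} (h1 : x.p = y.p) (h2 : x.q = y.q) (h3 : x.t = y.t) : x = y :=
  Prod.ext h1 (Prod.ext h2 h3)

@[fun_prop] theorem continuous_p : Continuous (p : Heis d → Rd d) :=
  (continuous_fst : Continuous fun x : Rd d × Rd d × ℝ => x.1)
@[fun_prop] theorem continuous_q : Continuous (q : Heis d → Rd d) :=
  (continuous_fst.comp continuous_snd : Continuous fun x : Rd d × Rd d × ℝ => x.2.1)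
@[fun_prop] theorem continuous_t : Continuous (t : Heis d → ℝ) :=
  (continuous_snd.comp continuous_snd : Continuous fun x : Rd d × Rd d × ℝ => x.2.2)

/-- The group law `(p, q, t) (p', q', t') = (p + p', q + q', t + t' + p · q')`. -/
instance : Mul (Heis d) :=
  ⟨fun x y => mk (x.p + y.p) (x.q + y.q) (x.t + y.t + inner ℝ x.p y.q)⟩

instance : One (Heis d) := ⟨mk 0 0 0⟩

instance : Inv (Heis d) := ⟨fun x => mk (-x.p) (-x.q) (-x.t + inner ℝ x.p x.q)⟩

theorem mul_def (x y : Heis d) :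
    x * y = mk (x.p + y.p) (x.q + y.q) (x.t + y.t + inner ℝ x.p y.q) := rfl

theorem one_def : (1 : Heis d) = mk 0 0 0 := rfl

theorem inv_def (x : Heis d) : x⁻¹ = mk (-x.p) (-x.q) (-x.t + inner ℝ x.p x.q) := rfl

instance : Group (Heis d) where
  mul_assoc x y z := by
    simp only [mul_def]
    refine ext (add_assoc _ _ _) (add_assoc _ _ _) ?_
    simp only [p_mk, q_mk, t_mk, inner_add_left, inner_add_right]
    ring
  one_mul x := by
    simp only [mul_def, one_def]
    refine ext (by simp) (by simp) (by simp)
  mul_one x := by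
    simp only [mul_def, one_def]
    refine ext (by simp) (by simp) (by simp)
  inv_mul_cancel x := by
    simp only [mul_def, one_def, inv_def]
    refine ext (by simp) (by simp) (by simp)

/-- Lebesgue measure on `ℍ^d` is invariant under left multiplication. -/
theorem measurePreserving_mul_left (g : Heis d) :
    MeasurePreserving (fun x : Heis d => g * x) volume volume := by
  have h2 : MeasurePreserving
      (fun z : Rd d × ℝ => (g.q + z.1, g.t + z.2 + inner ℝ g.p z.1))
      (volume : Measure (Rd d × ℝ)) volume := by
    refine MeasurePreserving.skew_product (μa := (volume : Measure (Rd d)))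
      (μc := (volume : Measure ℝ)) (g := fun q t => g.t + t + inner ℝ g.p q)
      (measurePreserving_add_left volume g.q) ?_ ?_
    · exact Continuous.measurable (by fun_prop)
    · refine Eventually.of_forall fun q => ?_
      have : (fun t : ℝ => g.t + t + inner ℝ g.p q)
          = fun t : ℝ => (g.t + inner ℝ g.p q) + t := by
        funext t; ring
      rw [this]
      exact (measurePreserving_add_left volume _).map_eq
  exact (measurePreserving_add_left (volume : Measure (Rd d)) g.p).prod h2

end Heis

/-- `L²(ℝ^d)`. -/
abbrev L2Rd (d : ℕ) : Type := Lp ℂ 2 (volume : Measure (Rd d))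

/-- `L²(ℍ^d)`. -/
abbrev L2Heis (d : ℕ) : Type := Lp ℂ 2 (volume : Measure (Heis d))

/-- Left translation on `L²(ℍ^d)`: `(L_g ψ)(x) = ψ(g⁻¹ x)`. -/
def leftTranslation {d : ℕ} (g : Heis d) : L2Heis d →ₗᵢ[ℂ] L2Heis d :=
  Lp.compMeasurePreservingₗᵢ ℂ (fun x => g⁻¹ * x) (Heis.measurePreserving_mul_left g⁻¹)

/-! ### The lattice subgroups -/

/-- The lattice point `M k` of `M ℤ^d`. -/
def latticePoint {d : ℕ} (M : GL (Fin d) ℝ) (k : Fin d → ℤ) : Rd d :=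
  WithLp.toLp 2 ((M : Matrix (Fin d) (Fin d) ℝ).mulVec fun i => (k i : ℝ))

theorem latticePoint_add {d : ℕ} (M : GL (Fin d) ℝ) (k l : Fin d → ℤ) :
    latticePoint M (k + l) = latticePoint M k + latticePoint M l := by
  have : (fun i => ((k + l) i : ℝ)) = (fun i => (k i : ℝ)) + fun i => (l i : ℝ) := by
    funext i; simp
  rw [latticePoint, this, Matrix.mulVec_add]
  rfl

theorem latticePoint_zero {d : ℕ} (M : GL (Fin d) ℝ) : latticePoint M 0 = 0 := by
  simpa using latticePoint_add M 0 0

theorem latticePoint_neg {d : ℕ} (M : GL (Fin d) ℝ) (k : Fin d → ℤ) :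
    latticePoint M (-k) = -latticePoint M k := by
  rw [eq_neg_iff_add_eq_zero, ← latticePoint_add]
  simp [latticePoint_zero]

/-- `Aᵗ B` has integer entries. -/
def IntegralPair {d : ℕ} (A B : GL (Fin d) ℝ) : Prop :=
  ∃ C : Matrix (Fin d) (Fin d) ℤ,
    (A : Matrix (Fin d) (Fin d) ℝ).transpose * (B : Matrix (Fin d) (Fin d) ℝ)
      = C.map (fun z : ℤ => (z : ℝ))

theorem IntegralPair.inner_eq {d : ℕ} {A B : GL (Fin d) ℝ} (h : IntegralPair A B)
    (m n : Fin d → ℤ) : ∃ k : ℤ, inner ℝ (latticePoint A m) (latticePoint B n) = (k : ℝ) := by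
  obtain ⟨C, hC⟩ := h
  refine ⟨dotProduct m (C.mulVec n), ?_⟩
  have h1 : inner ℝ (latticePoint A m) (latticePoint B n)
      = dotProduct (fun i => (m i : ℝ))
        (((A : Matrix (Fin d) (Fin d) ℝ).transpose * (B : Matrix (Fin d) (Fin d) ℝ)).mulVec
          fun i => (n i : ℝ)) := by
    rw [latticePoint, latticePoint, EuclideanSpace.inner_toLp_toLp, ← Matrix.mulVec_mulVec,
      Matrix.dotProduct_mulVec, Matrix.vecMul_transpose, dotProduct_comm]
    rfl
  rw [h1, hC]
  simp [dotProduct, Matrix.mulVec]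

/-- The lattice subgroup `Γ = A ℤ^d × B ℤ^d × ℤ` of `ℍ^d`. -/
def lattice {d : ℕ} (A B : GL (Fin d) ℝ) (h : IntegralPair A B) : Subgroup (Heis d) where
  carrier := {x | ∃ (m n : Fin d → ℤ) (k : ℤ), x = Heis.mk (latticePoint A m) (latticePoint B n) (k : ℝ)}
  mul_mem' := by
    rintro _ _ ⟨m, n, k, rfl⟩ ⟨m', n', k', rfl⟩
    obtain ⟨c, hc⟩ := h.inner_eq m n'
    refine ⟨m + m', n + n', k + k' + c, ?_⟩
    rw [latticePoint_add, latticePoint_add, Heis.mul_def]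
    refine Heis.ext rfl rfl ?_
    simp [hc]
  one_mem' := ⟨0, 0, 0, by simp [latticePoint_zero, Heis.one_def]⟩
  inv_mem' := by
    rintro _ ⟨m, n, k, rfl⟩
    obtain ⟨c, hc⟩ := h.inner_eq m n
    refine ⟨-m, -n, -k + c, ?_⟩
    rw [latticePoint_neg, latticePoint_neg, Heis.inv_def]
    refine Heis.ext rfl rfl ?_
    simp [hc]

/-- `Γ₁ = A ℤ^d × B ℤ^d`, as the set of elements `(p, q, 0)` of `ℍ^d`. -/
def latticeOne {d : ℕ} (A B : GL (Fin d) ℝ) : Set (Heis d) :=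
  {x | ∃ m n : Fin d → ℤ, x = Heis.mk (latticePoint A m) (latticePoint B n) 0}

/-! ### The Schrödinger representations -/

/-- The factor `e^{2πiλt} e^{-2πiλ q·y}` of the Schrödinger representation, `x = (p, q, t)`. -/
def phase {d : ℕ} (l : ℝ) (x : Heis d) (y : Rd d) : ℂ :=
  Complex.exp (2 * Real.pi * Complex.I * l * x.t)
    * Complex.exp (-(2 * Real.pi * Complex.I * l * (inner ℝ x.q y : ℝ)))

theorem norm_phase {d : ℕ} (l : ℝ) (x : Heis d) (y : Rd d) : ‖phase l x y‖ = 1 := by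
  simp [phase, Complex.norm_exp]

theorem continuous_phase {d : ℕ} (l : ℝ) :
    Continuous fun z : Heis d × Rd d => phase l z.1 z.2 := by
  unfold phase
  fun_prop

theorem memLp_phase_mul {d : ℕ} (l : ℝ) (x : Heis d) {f : Rd d → ℂ} (hf : MemLp f 2 volume) :
    MemLp (fun y => phase l x y * f y) 2 volume := by
  refine MemLp.of_le (g := f) hf ?_ ?_
  · exact ((continuous_phase l).comp (by fun_prop :
      Continuous fun y : Rd d => (x, y))).aestronglyMeasurable.mul hf.1
  · exact Eventually.of_forall fun y => by simp [norm_phase]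

theorem memLp_schrodinger {d : ℕ} (l : ℝ) (x : Heis d) (f : L2Rd d) :
    MemLp (fun y => phase l x y * f (y - x.p)) 2 volume :=
  memLp_phase_mul l x
    ((Lp.memLp f).comp_measurePreserving (measurePreserving_sub_right volume x.p))

/-- The Schrödinger representation `π_λ` of `ℍ^d` on `L²(ℝ^d)`:
`(π_λ(p, q, t) f)(y) = e^{2πiλt} e^{-2πiλ q·y} f(y - p)`. -/
def schrodinger {d : ℕ} (l : ℝ) (x : Heis d) : L2Rd d →ₗᵢ[ℂ] L2Rd d where
  toFun f := (memLp_schrodinger l x f).toLp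
  map_add' f g := by
    rw [← MemLp.toLp_add (memLp_schrodinger l x f) (memLp_schrodinger l x g),
      MemLp.toLp_eq_toLp_iff]
    have h := (measurePreserving_sub_right (volume : Measure (Rd d)) x.p).quasiMeasurePreserving.ae
      (Lp.coeFn_add f g)
    filter_upwards [h] with y hy
    simp only [hy, Pi.add_apply, mul_add]
  map_smul' c f := by
    rw [RingHom.id_apply, ← MemLp.toLp_const_smul c (memLp_schrodinger l x f), MemLp.toLp_eq_toLp_iff]
    have h := (measurePreserving_sub_right (volume : Measure (Rd d)) x.p).quasiMeasurePreserving.ae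
      (Lp.coeFn_smul c f)
    filter_upwards [h] with y hy
    simp only [hy, Pi.smul_apply, smul_eq_mul, mul_left_comm]
  norm_map' f := by
    have h1 : ‖(memLp_schrodinger l x f).toLp‖
        = (eLpNorm (fun y => f (y - x.p)) 2 volume).toReal := by
      rw [Lp.norm_toLp]
      congr 1
      refine eLpNorm_congr_norm_ae (Eventually.of_forall fun y => ?_)
      simp [norm_phase]
    refine h1.trans ?_
    rw [Lp.norm_def]
    congr 1
    exact eLpNorm_comp_measurePreserving (Lp.aestronglyMeasurable f)
      (measurePreserving_sub_right volume x.p)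

theorem continuous_phase_mul {d : ℕ} (l : ℝ) (f : L2Rd d) :
    Continuous fun x : Heis d => (memLp_phase_mul l x (Lp.memLp f)).toLp := by
  refine continuous_iff_continuousAt.2 fun x₀ => ?_
  unfold ContinuousAt
  rw [Lp.tendsto_Lp_iff_tendsto_eLpNorm'' _ (fun x => memLp_phase_mul l x (Lp.memLp f)) _
    (memLp_phase_mul l x₀ (Lp.memLp f))]
  have hm : ∀ x : Heis d, AEStronglyMeasurable
      (fun y => phase l x y * f y - phase l x₀ y * f y) volume := fun x =>
    (memLp_phase_mul l x (Lp.memLp f)).1.sub (memLp_phase_mul l x₀ (Lp.memLp f)).1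
  have key : Tendsto (fun x : Heis d =>
      ∫⁻ y, ‖phase l x y * f y - phase l x₀ y * f y‖ₑ ^ (2 : ℝ)) (𝓝 x₀)
      (𝓝 (∫⁻ _ : Rd d, 0)) := by
    refine tendsto_lintegral_filter_of_dominated_convergence'
      (fun y => (2 * ‖f y‖ₑ) ^ (2 : ℝ)) ?_ ?_ ?_ ?_
    · exact Eventually.of_forall fun x => ((hm x).enorm).pow_const _
    · refine Eventually.of_forall fun x => Eventually.of_forall fun y => ?_
      have h1 : ∀ z : Heis d, ‖phase l z y‖ₑ = 1 := fun z => by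
        rw [← ofReal_norm, norm_phase, ENNReal.ofReal_one]
      gcongr
      refine (enorm_sub_le).trans ?_
      rw [enorm_mul, enorm_mul, h1, h1, one_mul, two_mul]
    · have := (eLpNorm_lt_top_iff_lintegral_rpow_enorm_lt_top (p := 2) (by norm_num)
        (by norm_num)).1 (Lp.memLp f).2
      simp only [ENNReal.toReal_ofNat] at this
      simp_rw [ENNReal.mul_rpow_of_nonneg _ _ (by norm_num : (0 : ℝ) ≤ 2)]
      rw [lintegral_const_mul'' _ ((Lp.aestronglyMeasurable f).enorm.pow_const _)]
      exact (ENNReal.mul_lt_top (by simp) this).ne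
    · refine Eventually.of_forall fun y => ?_
      have hc : Continuous fun x : Heis d =>
          ‖phase l x y * f y - phase l x₀ y * f y‖ₑ ^ (2 : ℝ) := by
        have h1 : Continuous fun x : Heis d => phase l x y :=
          (continuous_phase l).comp (by fun_prop : Continuous fun x : Heis d => (x, y))
        have h2 : Continuous fun x : Heis d => phase l x y * f y - phase l x₀ y * f y :=
          (h1.mul continuous_const).sub continuous_const
        exact ENNReal.continuous_rpow_const.comp h2.enorm
      simpa using hc.tendsto x₀
  rw [lintegral_zero] at key
  have h3 := ((ENNReal.continuous_rpow_const (y := (1 / 2 : ℝ))).tendsto 0).comp key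
  rw [ENNReal.zero_rpow_of_pos (by norm_num)] at h3
  refine h3.congr fun x => ?_
  rw [eLpNorm_eq_lintegral_rpow_enorm_toReal (by norm_num) (by norm_num)]
  simp

/-- The Schrödinger representations are strongly continuous. -/
theorem continuous_schrodinger {d : ℕ} (l : ℝ) (f : L2Rd d) :
    Continuous fun x : Heis d => schrodinger l x f := by
  let T : Heis d → L2Rd d := fun x => Lp.compMeasurePreserving (fun y => y - x.p)
    (measurePreserving_sub_right volume x.p) f
  have hT : Continuous T := by
    have hg : Continuous fun x : Heis d =>
        (⟨fun y => y - x.p, by fun_prop⟩ : C(Rd d, Rd d)) := by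
      refine ContinuousMap.continuous_of_continuous_uncurry _ ?_
      exact (by fun_prop : Continuous fun z : Heis d × Rd d => z.2 - z.1.p)
    exact Continuous.compMeasurePreservingLp (f := fun _ : Heis d => f) continuous_const hg
      (fun x => measurePreserving_sub_right volume x.p) (by norm_num)
  have hS : ∀ x, schrodinger l x f = (memLp_phase_mul l x (Lp.memLp (T x))).toLp := by
    intro x
    change (memLp_schrodinger l x f).toLp = _
    rw [MemLp.toLp_eq_toLp_iff]
    filter_upwards [Lp.coeFn_compMeasurePreserving f
      (measurePreserving_sub_right (volume : Measure (Rd d)) x.p)] with y hy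
    rw [hy]
    rfl
  have hd : ∀ (x : Heis d) (g h : L2Rd d),
      dist (memLp_phase_mul l x (Lp.memLp g)).toLp (memLp_phase_mul l x (Lp.memLp h)).toLp
        = dist g h := by
    intro x g h
    rw [dist_eq_norm, dist_eq_norm, ← MemLp.toLp_sub, Lp.norm_toLp, Lp.norm_def]
    congr 1
    refine eLpNorm_congr_norm_ae ?_
    filter_upwards [Lp.coeFn_sub g h] with y hy
    rw [hy, Pi.sub_apply, Pi.sub_apply, ← mul_sub, norm_mul, norm_phase, one_mul]
  refine continuous_iff_continuousAt.2 fun x₀ => ?_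
  unfold ContinuousAt
  have h1 : Tendsto (fun x => dist (T x) (T x₀)) (𝓝 x₀) (𝓝 0) :=
    tendsto_iff_dist_tendsto_zero.1 (hT.tendsto x₀)
  have h2 := tendsto_iff_dist_tendsto_zero.1 ((continuous_phase_mul l (T x₀)).tendsto x₀)
  rw [tendsto_iff_dist_tendsto_zero]
  refine squeeze_zero (fun _ => dist_nonneg) (fun x => ?_) (by simpa using h1.add h2)
  change dist (schrodinger l x f) (schrodinger l x₀ f) ≤ _
  rw [hS, hS, ← hd x (T x) (T x₀)]
  exact dist_triangle _ _ _

theorem integrable_smul_schrodinger {d : ℕ} (l : ℝ) {φ : Heis d → ℂ} (hφ : Integrable φ)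
    (f : L2Rd d) : Integrable fun x => φ x • schrodinger l x f := by
  refine Integrable.mono' (g := fun x => ‖φ x‖ * ‖f‖) (hφ.norm.mul_const _) ?_ ?_
  · exact hφ.1.smul (continuous_schrodinger l f).aestronglyMeasurable
  · exact Eventually.of_forall fun x => by simp [norm_smul]

/-! ### The group Fourier transform -/

/-- The Fourier transform at `λ` of an integrable function `φ` on `ℍ^d`: the bounded operator
`∫ φ(x) π_λ(x) dx` on `L²(ℝ^d)` (strong integral). -/
def fourierOp {d : ℕ} {φ : Heis d → ℂ} (hφ : Integrable φ) (l : ℝ) : L2Rd d →L[ℂ] L2Rd d :=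
  LinearMap.mkContinuous
    { toFun := fun f => ∫ x, φ x • schrodinger l x f
      map_add' := fun f g => by
        simp only [map_add, smul_add]
        exact integral_add (integrable_smul_schrodinger l hφ f)
          (integrable_smul_schrodinger l hφ g)
      map_smul' := fun c f => by
        simp only [map_smul, smul_comm _ c, RingHom.id_apply]
        exact integral_smul c _ }
    (∫ x, ‖φ x‖) fun f => by
      refine (norm_integral_le_integral_norm _).trans_eq ?_
      simp [norm_smul, integral_mul_const]

/-- The square of the Hilbert–Schmidt norm of a bounded operator: the supremum of
`∑ ‖T e‖²` over the finite orthonormal sets, which is the value of `∑ ‖T e_i‖²` on every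
orthonormal basis `(e_i)`. It is infinite if `T` is not a Hilbert–Schmidt operator. -/
def hsNormSq {E : Type*} [NormedAddCommGroup E] [InnerProductSpace ℂ E] (T : E →L[ℂ] E) :
    ℝ≥0∞ :=
  ⨆ s : {s : Finset E // Orthonormal ℂ (fun e : s => (e : E))}, ∑ e ∈ s.1, ‖T e‖ₑ ^ 2

/-- The square of the norm of an operator field `λ ↦ H(λ)` in
`L²(ℝ*, HS(L²(ℝ^d)), |λ|^d dλ)`. -/
def fieldNormSq {d : ℕ} (H : ℝ → L2Rd d →L[ℂ] L2Rd d) : ℝ≥0∞ :=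
  ∫⁻ l : ℝ, hsNormSq (H l) * ENNReal.ofReal (|l| ^ d)

/-- `H` belongs to `L²(ℝ*, HS(L²(ℝ^d)), |λ|^d dλ)`. Since `L²(ℝ^d)` is separable, weak
measurability is the right measurability. -/
def IsL2Field {d : ℕ} (H : ℝ → L2Rd d →L[ℂ] L2Rd d) : Prop :=
  (∀ f g : L2Rd d, AEMeasurable (fun l => inner ℂ f (H l g)) volume) ∧ fieldNormSq H < ∞

/-- `H` is the (Plancherel) Fourier transform `ℱψ` of `ψ ∈ L²(ℍ^d)`: the Fourier transform on
`L²(ℍ^d)` is the closure of the one given on `L¹ ∩ L²` by the integral `∫ φ(x) π_λ(x) dx`. -/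
def IsFourierTransform {d : ℕ} (ψ : L2Heis d) (H : ℝ → L2Rd d →L[ℂ] L2Rd d) : Prop :=
  IsL2Field H ∧ ∃ (φ : ℕ → L2Heis d) (hφ : ∀ n, Integrable (φ n)),
    Tendsto φ atTop (𝓝 ψ) ∧
      Tendsto (fun n => fieldNormSq fun l => fourierOp (hφ n) l - H l) atTop (𝓝 0)

/-! ### The operator field `H_ε` -/

theorem memLp_dilate {d : ℕ} {l : ℝ} (hl : l ≠ 0) (u : L2Rd d) :
    MemLp (fun y : Rd d => ((|l| ^ ((d : ℝ) / 2) : ℝ) : ℂ) * u (l • y)) 2 volume := by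
  refine MemLp.const_mul ?_ _
  have h := Measure.map_addHaar_smul (volume : Measure (Rd d)) hl
  have hu : MemLp u 2 (Measure.map (fun y : Rd d => l • y) volume) := by
    rw [h]
    exact (Lp.memLp u).smul_measure ENNReal.ofReal_ne_top
  exact hu.comp_of_map (by fun_prop)

/-- The normalized dilate `u_λ(y) = |λ|^{d/2} u(λ y)`, for `λ ≠ 0` (and `0` for `λ = 0`). -/
def dilate {d : ℕ} (l : ℝ) (u : L2Rd d) : L2Rd d :=
  if hl : l ≠ 0 then (memLp_dilate hl u).toLp else 0

/-- The field `H_ε(λ) = u_λ ⊗ u_λ : f ↦ ⟨f, u_λ⟩ u_λ` for `ε < λ ≤ 1`, and `0` otherwise. -/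
def projField {d : ℕ} (u : L2Rd d) (ε : ℝ) (l : ℝ) : L2Rd d →L[ℂ] L2Rd d :=
  if ε < l ∧ l ≤ 1 then InnerProductSpace.rankOne ℂ (dilate l u) (dilate l u) else 0

/-! ### Frames -/

/-- The family `v` is a frame for the closed subspace `V` of `E`. -/
def IsFrameFor {ι E : Type*} [NormedAddCommGroup E] [InnerProductSpace ℂ E] (v : ι → E)
    (V : Submodule ℂ E) : Prop :=
  (∀ i, v i ∈ V) ∧ ∃ a b : ℝ, 0 < a ∧ a ≤ b ∧ ∀ φ ∈ V,
    Summable (fun i => ‖inner ℂ (v i) φ‖ ^ 2) ∧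
      a * ‖φ‖ ^ 2 ≤ ∑' i, ‖inner ℂ (v i) φ‖ ^ 2 ∧
      ∑' i, ‖inner ℂ (v i) φ‖ ^ 2 ≤ b * ‖φ‖ ^ 2

/-- `⟨ψ⟩_{Γ,L}`, the closed linear span of the left translates `L_γ ψ`, `γ ∈ Γ`. -/
def cyclicSpace {d : ℕ} (Γ : Subgroup (Heis d)) (ψ : L2Heis d) : Submodule ℂ (L2Heis d) :=
  (Submodule.span ℂ (Set.range fun γ : Γ => leftTranslation (γ : Heis d) ψ)).topologicalClosure

end HeisFrame

end

noncomputable section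

namespace HeisFrame

/-! ### Square integrable functions and their sections -/

section Sections

variable {α β : Type*} [MeasurableSpace α] [MeasurableSpace β] {μ : Measure α} {ν : Measure β}

/-! The frame property is a statement about the Gram matrix of the translates, and the Fourier
transform makes that matrix explicit. The argument has two halves.

Plancherel. Conjugation by the dilation turns `π_l(p,q,t)` into `v ↦ e^{2πi(lt - q·y)} v(y - lp)`.
If the input is described by its Euclidean Fourier transform as well, the operator `∫ φ(x) π_l(x)
dx` acquires the kernel `e^{2πi y·ξ} φ̂(lξ, y, -l)`, where `φ̂` is the Fourier transform on
`ℝ^{2d+1}` (`inner_fourierOp_schwartz`, `fourier_transport`). The Hilbert–Schmidt norm is the `L²`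
norm of the kernel (`hsNormSq_eq_lintegral`), and `(l, y, ξ) ↦ (lξ, y, -l)` carries `|l|^d dl dy dξ`
to Lebesgue measure (`measurePreserving_freqMap`). The group transform is therefore the Euclidean
one in other coordinates: `kernelTransform` is a surjective isometry, which gives existence and
uniqueness of `ψ_ε`.

Gram matrix. Left translation by `g` multiplies the transform by `π_l(g)` on the left, so the inner
product of the translates by `g` and `g'` is `∫_ε^1 l^d ⟨π_l(g) u_l, π_l(g') u_l⟩ dl`
(`inner_leftTranslation`). Each element of `Γ` is a point of `Γ₁` together with a central integer
`k`, and the centre acts by `e^{2πikl}`. Orthonormality over `Γ₁` then leaves a direct sum of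
Toeplitz matrices, all with symbol `w(l) = l^d` on `(ε,1]` and `0` on the rest of `(0,1]`
(`hasToeplitzGram_translates`).

For a finite combination `φ` of the translates, with trigonometric polynomials `P_j` built from its
coefficients, `‖φ‖² = ∑_j ∫ w|P_j|²`, whereas Parseval gives `∑ |⟨v_i, φ⟩|² = ∑_j ∫ w²|P_j|²`. Since
`w` is either `0` or in `[ε^d, 1]`, pointwise `ε^d w ≤ w² ≤ w`, and the frame inequalities follow on
the span (`frame_bounds_span`); they pass to its closure (`frame_bounds_closure`). -/

theorem lintegral_enorm_sq {f : α → ℂ} : ∫⁻ x, ‖f x‖ₑ ^ 2 ∂μ = eLpNorm f 2 μ ^ 2 := by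
  have h := eLpNorm_nnreal_pow_eq_lintegral (f := f) (μ := μ) (p := 2) (by norm_num)
  simpa using h.symm

theorem enorm_toLp_sq {f : α → ℂ} (hf : MemLp f 2 μ) :
    ‖hf.toLp‖ₑ ^ 2 = ∫⁻ x, ‖f x‖ₑ ^ 2 ∂μ := by
  rw [lintegral_enorm_sq, Lp.enorm_toLp]

theorem enorm_Lp_sq (f : Lp ℂ 2 μ) : ‖f‖ₑ ^ 2 = ∫⁻ x, ‖f x‖ₑ ^ 2 ∂μ := by
  rw [lintegral_enorm_sq, Lp.enorm_def]

theorem memLp_two_iff_lintegral {f : α → ℂ} (hf : AEStronglyMeasurable f μ) :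
    MemLp f 2 μ ↔ ∫⁻ x, ‖f x‖ₑ ^ 2 ∂μ < ∞ := by
  rw [lintegral_enorm_sq, MemLp, and_iff_right hf]
  simp [ENNReal.pow_lt_top_iff]

theorem ae_memLp_section [SFinite ν] [SFinite μ] {K : α × β → ℂ} (hK : MemLp K 2 (μ.prod ν)) :
    ∀ᵐ y ∂μ, MemLp (fun x => K (y, x)) 2 ν := by
  have h1 := (memLp_two_iff_integrable_sq_norm hK.1).1 hK
  filter_upwards [h1.prod_right_ae, hK.1.prodMk_left] with y hy hy'
  exact (memLp_two_iff_integrable_sq_norm hy').2 hy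

theorem inner_toLp {f g : α → ℂ} (hf : MemLp f 2 μ) (hg : MemLp g 2 μ) :
    inner ℂ hf.toLp hg.toLp = ∫ x, (starRingEnd ℂ) (f x) * g x ∂μ := by
  rw [L2.inner_def]
  refine integral_congr_ae ?_
  filter_upwards [hf.coeFn_toLp, hg.coeFn_toLp] with x h1 h2
  rw [h1, h2, RCLike.inner_apply, mul_comm]

theorem inner_Lp (f g : Lp ℂ 2 μ) :
    inner ℂ f g = ∫ x, (starRingEnd ℂ) (f x) * g x ∂μ := by
  rw [L2.inner_def]
  refine integral_congr_ae (Eventually.of_forall fun x => ?_)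
  simp only [RCLike.inner_apply, mul_comm]

theorem memLp_conj {f : α → ℂ} {p : ℝ≥0∞} (hf : MemLp f p μ) :
    MemLp (fun x => (starRingEnd ℂ) (f x)) p μ :=
  hf.of_le (Complex.continuous_conj.comp_aestronglyMeasurable hf.1)
    (Eventually.of_forall fun x => by simp)

theorem memLp_tensor [SFinite ν] [SFinite μ] {f : α → ℂ} {g : β → ℂ} (hf : MemLp f 2 μ)
    (hg : MemLp g 2 ν) : MemLp (fun z : α × β => f z.1 * g z.2) 2 (μ.prod ν) := by
  have hm : AEStronglyMeasurable (fun z : α × β => f z.1 * g z.2) (μ.prod ν) :=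
    hf.1.comp_fst.mul hg.1.comp_snd
  rw [memLp_two_iff_integrable_sq_norm hm]
  simpa [mul_pow] using ((memLp_two_iff_integrable_sq_norm hf.1).1 hf).mul_prod
    ((memLp_two_iff_integrable_sq_norm hg.1).1 hg)

theorem lintegral_tensor [SFinite ν] [SFinite μ] {f : α → ℂ} {g : β → ℂ}
    (hf : AEStronglyMeasurable f μ) (hg : AEStronglyMeasurable g ν) :
    ∫⁻ z, ‖f z.1 * g z.2‖ₑ ^ 2 ∂(μ.prod ν)
      = (∫⁻ x, ‖f x‖ₑ ^ 2 ∂μ) * ∫⁻ y, ‖g y‖ₑ ^ 2 ∂ν := by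
  simp only [enorm_mul, mul_pow]
  exact lintegral_prod_mul (hf.enorm.pow_const 2) (hg.enorm.pow_const 2)

end Sections

/-! ### Orthonormal families in separable spaces -/

section Hilbert

variable {H : Type*} [NormedAddCommGroup H] [InnerProductSpace ℂ H]

theorem sum_enorm_inner_sq_le {ι : Type*} {v : ι → H} (hv : Orthonormal ℂ v) (s : Finset ι)
    (x : H) : ∑ i ∈ s, ‖inner ℂ (v i) x‖ₑ ^ 2 ≤ ‖x‖ₑ ^ 2 := by
  have h := hv.sum_inner_products_le x (s := s)
  simp only [← ofReal_norm, ← ENNReal.ofReal_pow (norm_nonneg _)]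
  rw [← ENNReal.ofReal_sum_of_nonneg fun i _ => by positivity]
  exact ENNReal.ofReal_le_ofReal h

theorem tsum_enorm_inner_sq {ι : Type*} (b : HilbertBasis ι ℂ H) (x : H) :
    ∑' i, ‖inner ℂ (b i) x‖ₑ ^ 2 = ‖x‖ₑ ^ 2 := by
  have h1 : HasSum (fun i => ‖inner ℂ (b i) x‖ ^ 2) (‖x‖ ^ 2) := by
    have h := (b.hasSum_inner_mul_inner x x).mapL Complex.reCLM
    rw [show ‖x‖ ^ 2 = Complex.reCLM (inner ℂ x x) from (inner_self_eq_norm_sq (𝕜 := ℂ) x).symm]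
    convert h using 2 with i
    rw [Complex.reCLM_apply, ← inner_conj_symm x, Complex.conj_mul']
    norm_cast
  simp only [← ofReal_norm, ← ENNReal.ofReal_pow (norm_nonneg _)]
  rw [← h1.tsum_eq, ENNReal.ofReal_tsum_of_nonneg (fun i => by positivity) h1.summable]

/-- Distinct orthonormal vectors are at distance `√2`, so the balls of radius `1/2` around them are
disjoint open sets. Countability is needed to exchange a sum over a Hilbert basis with an integral.
-/
theorem countable_of_orthonormal [TopologicalSpace.SeparableSpace H] {w : Set H}
    (hw : Orthonormal ℂ ((↑) : w → H)) : w.Countable := by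
  have hd : w.PairwiseDisjoint fun x => Metric.ball x (1 / 2) := by
    intro x hx y hy hxy
    refine Metric.ball_disjoint_ball ?_
    have h1 : ‖x - y‖ ^ 2 = 2 := by
      rw [@norm_sub_sq ℂ, hw.1 ⟨x, hx⟩, hw.1 ⟨y, hy⟩,
        hw.2 (i := ⟨x, hx⟩) (j := ⟨y, hy⟩) (by simpa using hxy)]
      norm_num
    rw [dist_eq_norm]
    nlinarith [norm_nonneg (x - y)]
  exact hd.countable_of_isOpen (fun _ _ => Metric.isOpen_ball)
    fun x _ => ⟨x, Metric.mem_ball_self (by norm_num)⟩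

theorem hsNormSq_comp_isometry (U : H →ₗᵢ[ℂ] H) (T : H →L[ℂ] H) :
    hsNormSq (U.toContinuousLinearMap ∘L T) = hsNormSq T := by
  simp only [hsNormSq, ContinuousLinearMap.comp_apply, LinearIsometry.coe_toContinuousLinearMap,
    ← ofReal_norm, LinearIsometry.norm_map]

theorem sum_enorm_sq_le_hsNormSq {ι : Type*} {v : ι → H} (hv : Orthonormal ℂ v)
    (s : Finset ι) (T : H →L[ℂ] H) : ∑ i ∈ s, ‖T (v i)‖ₑ ^ 2 ≤ hsNormSq T := by
  let j : ι ↪ H := ⟨v, hv.linearIndependent.injective⟩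
  have h1 : ∀ e : s.map j, (e : H) ∈ Set.range v := fun e => by
    obtain ⟨i, -, hi⟩ := Finset.mem_map.1 e.2
    exact ⟨i, hi⟩
  have hs : Orthonormal ℂ (fun e : s.map j => (e : H)) :=
    hv.toSubtypeRange.comp (fun e : s.map j => (⟨e, h1 e⟩ : Set.range v)) fun a b hab =>
      Subtype.ext (congrArg (fun z : Set.range v => (z : H)) hab)
  refine le_trans (le_of_eq ?_) (le_iSup (fun s : {s : Finset H // Orthonormal ℂ
    (fun e : s => (e : H))} => ∑ e ∈ s.1, ‖T e‖ₑ ^ 2) ⟨_, hs⟩)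
  exact (Finset.sum_map s j fun e => ‖T e‖ₑ ^ 2).symm

theorem hsNormSq_comp_equiv_le (V : H ≃ₗᵢ[ℂ] H) (T : H →L[ℂ] H) :
    hsNormSq (T ∘L V.toContinuousLinearEquiv.toContinuousLinearMap) ≤ hsNormSq T := by
  refine iSup_le fun s => ?_
  rw [← Finset.sum_coe_sort]
  exact sum_enorm_sq_le_hsNormSq (s.2.comp_linearIsometry V.toLinearIsometry) Finset.univ T

/-- A unitary maps orthonormal sets to orthonormal sets, which gives one inequality; the other is
the same inequality for `V.symm` and `T ∘ V`. -/
theorem hsNormSq_comp_equiv (V : H ≃ₗᵢ[ℂ] H) (T : H →L[ℂ] H) :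
    hsNormSq (T ∘L V.toContinuousLinearEquiv.toContinuousLinearMap) = hsNormSq T := by
  refine (hsNormSq_comp_equiv_le V T).antisymm ?_
  refine le_trans (le_of_eq ?_) (hsNormSq_comp_equiv_le V.symm _)
  congr 1
  ext x
  simp

end Hilbert

/-! ### Integral operators with square integrable kernels -/

section Kernel

variable {α : Type*} [MeasurableSpace α] {μ : Measure α} [SigmaFinite μ]

theorem integrable_kernel {K : α × α → ℂ} (hK : MemLp K 2 (μ.prod μ)) (f g : Lp ℂ 2 μ) :
    Integrable (fun z : α × α => (starRingEnd ℂ) (f z.1) * K z * g z.2) (μ.prod μ) := by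
  have h := (memLp_tensor (memLp_conj (Lp.memLp f)) (Lp.memLp g)).integrable_mul hK
  refine h.congr (Eventually.of_forall fun z => ?_)
  simp only [Pi.mul_apply]
  ring

/-- The function `(x, y) ↦ f(x) g(y)`. -/
def tensor (f g : Lp ℂ 2 μ) : Lp ℂ 2 (μ.prod μ) :=
  (memLp_tensor (Lp.memLp f) (Lp.memLp g)).toLp

theorem coeFn_tensor (f g : Lp ℂ 2 μ) :
    tensor f g =ᵐ[μ.prod μ] fun z => f z.1 * g z.2 :=
  MemLp.coeFn_toLp _

theorem norm_tensor (f g : Lp ℂ 2 μ) : ‖tensor f g‖ = ‖f‖ * ‖g‖ := by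
  have h : ‖tensor f g‖ₑ ^ 2 = (‖f‖ₑ * ‖g‖ₑ) ^ 2 := by
    rw [tensor, enorm_toLp_sq, lintegral_tensor (Lp.aestronglyMeasurable f)
      (Lp.aestronglyMeasurable g), mul_pow, enorm_Lp_sq, enorm_Lp_sq]
  have h2 := congrArg ENNReal.toReal h
  simp only [ENNReal.toReal_pow, ENNReal.toReal_mul, toReal_enorm] at h2
  exact (pow_left_inj₀ (norm_nonneg _) (by positivity) two_ne_zero).1 h2

theorem tensor_add_left (f f' g : Lp ℂ 2 μ) : tensor (f + f') g = tensor f g + tensor f' g := by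
  refine Lp.ext ?_
  filter_upwards [Measure.quasiMeasurePreserving_fst.ae (Lp.coeFn_add f f'),
    coeFn_tensor (f + f') g, coeFn_tensor f g, coeFn_tensor f' g,
    Lp.coeFn_add (tensor f g) (tensor f' g)] with z h1 h2 h3 h4 h5
  rw [h2, h5, Pi.add_apply, h3, h4, h1, Pi.add_apply, add_mul]

theorem tensor_add_right (f g g' : Lp ℂ 2 μ) :
    tensor f (g + g') = tensor f g + tensor f g' := by
  refine Lp.ext ?_
  filter_upwards [Measure.quasiMeasurePreserving_snd.ae (Lp.coeFn_add g g'),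
    coeFn_tensor f (g + g'), coeFn_tensor f g, coeFn_tensor f g',
    Lp.coeFn_add (tensor f g) (tensor f g')] with z h1 h2 h3 h4 h5
  rw [h2, h5, Pi.add_apply, h3, h4, h1, Pi.add_apply, mul_add]

theorem continuous_tensor_left (g : Lp ℂ 2 μ) : Continuous fun f => tensor f g :=
  AddMonoidHomClass.continuous_of_bound
    (AddMonoidHom.mk' (fun f => tensor f g) fun f f' => tensor_add_left f f' g) ‖g‖
    fun f => ((norm_tensor f g).trans (mul_comm _ _)).le

theorem continuous_tensor_right (f : Lp ℂ 2 μ) : Continuous fun g => tensor f g :=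
  AddMonoidHomClass.continuous_of_bound
    (AddMonoidHom.mk' (fun g => tensor f g) fun g g' => tensor_add_right f g g') ‖f‖
    fun g => (norm_tensor f g).le

/-- The integral is an inner product of `K` with an elementary tensor, and tensors depend
continuously on each factor. This allows kernels to be identified by testing on a dense set only. -/
theorem continuous_kernel_left {K : α × α → ℂ} (hK : MemLp K 2 (μ.prod μ)) (g : Lp ℂ 2 μ) :
    Continuous fun f : Lp ℂ 2 μ =>
      ∫ z, (starRingEnd ℂ) (f z.1) * K z * g z.2 ∂(μ.prod μ) := by
  have h : ∀ f : Lp ℂ 2 μ, ∫ z, (starRingEnd ℂ) (f z.1) * K z * g z.2 ∂(μ.prod μ)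
      = inner ℂ (tensor f (memLp_conj (Lp.memLp g)).toLp) hK.toLp := fun f => by
    rw [inner_Lp]
    refine integral_congr_ae ?_
    filter_upwards [coeFn_tensor f (memLp_conj (Lp.memLp g)).toLp, hK.coeFn_toLp,
      Measure.quasiMeasurePreserving_snd.ae (memLp_conj (Lp.memLp g)).coeFn_toLp] with z h1 h2 h3
    rw [h1, h2, h3, map_mul, Complex.conj_conj]
    ring
  simp_rw [h]
  exact (continuous_tensor_left _).inner continuous_const

theorem continuous_kernel_right {K : α × α → ℂ} (hK : MemLp K 2 (μ.prod μ)) (f : Lp ℂ 2 μ) :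
    Continuous fun g : Lp ℂ 2 μ =>
      ∫ z, (starRingEnd ℂ) (f z.1) * K z * g z.2 ∂(μ.prod μ) := by
  have h : ∀ g : Lp ℂ 2 μ, ∫ z, (starRingEnd ℂ) (f z.1) * K z * g z.2 ∂(μ.prod μ)
      = inner ℂ (memLp_conj hK).toLp (tensor (memLp_conj (Lp.memLp f)).toLp g) := fun g => by
    rw [inner_Lp]
    refine integral_congr_ae ?_
    filter_upwards [coeFn_tensor (memLp_conj (Lp.memLp f)).toLp g, (memLp_conj hK).coeFn_toLp,
      Measure.quasiMeasurePreserving_fst.ae (memLp_conj (Lp.memLp f)).coeFn_toLp] with z h1 h2 h3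
    rw [h1, h2, h3, Complex.conj_conj]
    ring
  simp_rw [h]
  exact continuous_const.inner (continuous_tensor_right _)

/-- `T` is the integral operator with kernel `K`. -/
def HasKernel (T : Lp ℂ 2 μ →L[ℂ] Lp ℂ 2 μ) (K : α × α → ℂ) : Prop :=
  ∀ f g : Lp ℂ 2 μ, inner ℂ f (T g) = ∫ z, (starRingEnd ℂ) (f z.1) * K z * g z.2 ∂(μ.prod μ)

theorem hasKernel_of_dense {T : Lp ℂ 2 μ →L[ℂ] Lp ℂ 2 μ} {K : α × α → ℂ}
    (hK : MemLp K 2 (μ.prod μ)) {D : Set (Lp ℂ 2 μ)} (hD : Dense D)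
    (h : ∀ f ∈ D, ∀ g ∈ D,
      inner ℂ f (T g) = ∫ z, (starRingEnd ℂ) (f z.1) * K z * g z.2 ∂(μ.prod μ)) :
    HasKernel T K := by
  have h1 : ∀ f ∈ D, ∀ g : Lp ℂ 2 μ,
      inner ℂ f (T g) = ∫ z, (starRingEnd ℂ) (f z.1) * K z * g z.2 ∂(μ.prod μ) := by
    intro f hf g
    exact congrFun (Continuous.ext_on hD (continuous_const.inner T.continuous)
      (continuous_kernel_right hK f) (h f hf)) g
  intro f g
  exact congrFun (Continuous.ext_on hD (continuous_id.inner continuous_const)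
    (continuous_kernel_left hK g) fun f hf => h1 f hf g) f

theorem HasKernel.sub {T T' : Lp ℂ 2 μ →L[ℂ] Lp ℂ 2 μ} {K K' : α × α → ℂ}
    (h : HasKernel T K) (h' : HasKernel T' K') (hK : MemLp K 2 (μ.prod μ))
    (hK' : MemLp K' 2 (μ.prod μ)) : HasKernel (T - T') (K - K') := by
  intro f g
  rw [_root_.sub_apply, inner_sub_right, h, h',
    ← integral_sub (integrable_kernel hK f g) (integrable_kernel hK' f g)]
  refine integral_congr_ae (Eventually.of_forall fun z => ?_)
  simp only [Pi.sub_apply]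
  ring

/-- `HasKernel` is a weak statement; here it is upgraded to the pointwise formula for `T g`.
Cauchy–Schwarz on the sections of `K` shows that the integral defines an `L²` function, and Fubini
identifies it with `T g`. -/
theorem enorm_kernel_apply_sq {T : Lp ℂ 2 μ →L[ℂ] Lp ℂ 2 μ} {K : α × α → ℂ}
    (hK : MemLp K 2 (μ.prod μ)) (h : HasKernel T K) (g : Lp ℂ 2 μ) :
    ‖T g‖ₑ ^ 2 = ∫⁻ y, ‖∫ x, K (y, x) * g x ∂μ‖ₑ ^ 2 ∂μ := by
  have hm : AEStronglyMeasurable (fun y => ∫ x, K (y, x) * g x ∂μ) μ :=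
    AEStronglyMeasurable.integral_prod_right' (f := fun z : α × α => K z * g z.2)
      (hK.1.mul (Lp.aestronglyMeasurable g).comp_snd)
  have hS : MemLp (fun y => ∫ x, K (y, x) * g x ∂μ) 2 μ := by
    rw [memLp_two_iff_lintegral hm]
    have hb : ∀ᵐ y ∂μ, ‖∫ x, K (y, x) * g x ∂μ‖ₑ ^ 2
        ≤ (∫⁻ x, ‖K (y, x)‖ₑ ^ 2 ∂μ) * ‖g‖ₑ ^ 2 := by
      filter_upwards [ae_memLp_section hK] with y hy
      have h1 : ∫ x, K (y, x) * g x ∂μ = inner ℂ (memLp_conj hy).toLp g := by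
        conv_rhs => rw [← Lp.toLp_coeFn g (Lp.memLp g), inner_toLp]
        simp
      rw [h1, show ∫⁻ x, ‖K (y, x)‖ₑ ^ 2 ∂μ = ‖(memLp_conj hy).toLp‖ₑ ^ 2 by
        rw [enorm_toLp_sq]; simp [enorm_eq_nnnorm], ← mul_pow]
      gcongr
      rw [← ofReal_norm, ← ofReal_norm, ← ofReal_norm, ← ENNReal.ofReal_mul (norm_nonneg _)]
      exact ENNReal.ofReal_le_ofReal (norm_inner_le_norm _ _)
    refine (lintegral_mono_ae hb).trans_lt ?_
    rw [lintegral_mul_const' _ _ (by simp)]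
    refine ENNReal.mul_lt_top ?_ (by simp)
    rw [lintegral_lintegral (f := fun y x => ‖K (y, x)‖ₑ ^ 2) (hK.1.enorm.pow_const 2)]
    exact (memLp_two_iff_lintegral hK.1).1 hK
  have hT : T g = hS.toLp := by
    refine ext_inner_left ℂ fun f => ?_
    rw [h, integral_prod _ (integrable_kernel hK f g)]
    conv_rhs => rw [← Lp.toLp_coeFn f (Lp.memLp f), inner_toLp]
    refine integral_congr_ae (Eventually.of_forall fun y => ?_)
    simp only [mul_assoc]
    exact integral_const_mul _ _
  rw [hT, enorm_toLp_sq]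

/-- For almost every `y`, the value of `T g` at `y` is, up to conjugation, the inner product of `g`
with the conjugate section `k` of the kernel. Integrating Bessel's inequality for `k` over `y`
bounds every finite orthonormal sum, and integrating Parseval's identity for a Hilbert basis shows
that the bound is reached. -/
theorem hsNormSq_eq_lintegral [TopologicalSpace.SeparableSpace (Lp ℂ 2 μ)]
    {T : Lp ℂ 2 μ →L[ℂ] Lp ℂ 2 μ} {K : α × α → ℂ} (hK : MemLp K 2 (μ.prod μ))
    (h : HasKernel T K) : hsNormSq T = ∫⁻ z, ‖K z‖ₑ ^ 2 ∂(μ.prod μ) := by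
  have hin : ∀ᵐ y ∂μ, ∃ k : Lp ℂ 2 μ, (∫⁻ x, ‖K (y, x)‖ₑ ^ 2 ∂μ = ‖k‖ₑ ^ 2) ∧
      ∀ g : Lp ℂ 2 μ, ‖∫ x, K (y, x) * g x ∂μ‖ₑ = ‖inner ℂ g k‖ₑ := by
    filter_upwards [ae_memLp_section hK] with y hy
    refine ⟨(memLp_conj hy).toLp, ?_, fun g => ?_⟩
    · rw [enorm_toLp_sq]; simp [enorm_eq_nnnorm]
    · have h1 : ∫ x, K (y, x) * g x ∂μ = inner ℂ (memLp_conj hy).toLp g := by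
        conv_rhs => rw [← Lp.toLp_coeFn g (Lp.memLp g), inner_toLp]
        simp
      rw [h1, ← ofReal_norm, ← ofReal_norm, norm_inner_symm]
  have hm : ∀ g : Lp ℂ 2 μ, AEMeasurable (fun y => ‖∫ x, K (y, x) * g x ∂μ‖ₑ ^ 2) μ :=
    fun g => (AEStronglyMeasurable.integral_prod_right' (f := fun z : α × α => K z * g z.2)
      (hK.1.mul (Lp.aestronglyMeasurable g).comp_snd)).enorm.pow_const 2
  have hK2 : ∫⁻ z, ‖K z‖ₑ ^ 2 ∂(μ.prod μ) = ∫⁻ y, ∫⁻ x, ‖K (y, x)‖ₑ ^ 2 ∂μ ∂μ :=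
    (lintegral_lintegral (f := fun y x => ‖K (y, x)‖ₑ ^ 2) (hK.1.enorm.pow_const 2)).symm
  rw [hK2]
  refine le_antisymm (iSup_le fun s => ?_) ?_
  · simp_rw [enorm_kernel_apply_sq hK h]
    rw [← lintegral_finsetSum' _ fun g _ => hm g]
    refine lintegral_mono_ae ?_
    filter_upwards [hin] with y ⟨k, hk, hk'⟩
    simp_rw [hk, hk']
    rw [← Finset.sum_coe_sort]
    exact sum_enorm_inner_sq_le s.2 Finset.univ k
  · obtain ⟨w, b, hb⟩ := exists_hilbertBasis ℂ (Lp ℂ 2 μ)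
    have hw : Orthonormal ℂ ((↑) : w → Lp ℂ 2 μ) := hb ▸ b.orthonormal
    have : Countable w := (countable_of_orthonormal hw).to_subtype
    have h1 : ∫⁻ y, ∫⁻ x, ‖K (y, x)‖ₑ ^ 2 ∂μ ∂μ = ∑' i, ‖T (b i)‖ₑ ^ 2 := by
      simp_rw [enorm_kernel_apply_sq hK h]
      rw [← lintegral_tsum fun i => hm (b i)]
      refine lintegral_congr_ae ?_
      filter_upwards [hin] with y ⟨k, hk, hk'⟩
      simp_rw [hk, hk']
      exact (tsum_enorm_inner_sq b k).symm
    rw [h1, ENNReal.tsum_eq_iSup_sum]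
    refine iSup_le fun s => ?_
    exact sum_enorm_sq_le_hsNormSq b.orthonormal s T

end Kernel

open FourierTransform SchwartzMap in
/-- On `L¹ ∩ L²` the Fourier transform of `L²` is given by the Fourier integral. -/
theorem fourier_Lp_ae_eq {E : Type*} [NormedAddCommGroup E] [InnerProductSpace ℝ E]
    [FiniteDimensional ℝ E] [MeasurableSpace E] [BorelSpace E] (f : Lp (α := E) ℂ 2)
    (hf : Integrable (f : E → ℂ)) :
    (Lp.fourierTransformₗᵢ E ℂ f : E → ℂ) =ᵐ[volume] 𝓕 (f : E → ℂ) := by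
  have hc : Continuous (𝓕 (f : E → ℂ)) :=
    VectorFourier.fourierIntegral_continuous Real.continuous_fourierChar continuous_inner hf
  refine ae_eq_of_integral_contDiff_smul_eq
    ((Lp.memLp _).locallyIntegrable (by norm_num)) hc.locallyIntegrable fun g hg hg' => ?_
  -- Both transforms are compared through test functions: the `L²` transform agrees with the
  -- distributional one, and the Fourier integral can be moved onto `G` by Fubini.
  let G : 𝓢(E, ℂ) := HasCompactSupport.toSchwartzMap (f := fun x => (g x : ℂ))
    (hg'.comp_left (g := fun r : ℝ => (r : ℂ)) (by simp)) (Complex.ofRealCLM.contDiff.comp hg)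
  have h1 := congrArg (fun T => T G) (Lp.fourier_toTemperedDistribution_eq f)
  simp only [TemperedDistribution.fourier_apply, Lp.toTemperedDistribution_apply] at h1
  have h2 := VectorFourier.integral_fourierIntegral_smul_eq_flip (μ := (volume : Measure E))
    (ν := (volume : Measure E)) (L := innerₗ E) Real.continuous_fourierChar
    continuous_inner G.integrable hf
  have h3 : ∀ F : E → ℂ, ∫ x, G x • F x = ∫ x, g x • F x := fun F => by
    refine integral_congr_ae (Eventually.of_forall fun x => ?_)
    exact Complex.coe_smul (g x) (F x)
  rw [h3] at h1
  have h4 : ∫ x, G x • 𝓕 (f : E → ℂ) x = ∫ x, 𝓕 G x • f x := by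
    rw [flip_innerₗ] at h2
    exact h2.symm
  rw [h3] at h4
  exact h1.symm.trans h4.symm

/-! ### Dilations -/

instance {d : ℕ} : SigmaFinite (volume : Measure (Heis d)) :=
  inferInstanceAs (SigmaFinite (volume : Measure (Rd d × Rd d × ℝ)))

section Dilation

variable {d : ℕ}

/-- The dilation `y ↦ l y` of `ℝ^d` as a measurable equivalence. -/
def smulEquiv {l : ℝ} (hl : l ≠ 0) : Rd d ≃ᵐ Rd d :=
  (Homeomorph.smulOfNeZero l hl).toMeasurableEquiv

theorem map_smulEquiv {l : ℝ} (hl : l ≠ 0) :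
    Measure.map (smulEquiv hl) (volume : Measure (Rd d))
      = ENNReal.ofReal |(l ^ d)⁻¹| • volume := by
  have h := Measure.map_addHaar_smul (volume : Measure (Rd d)) hl
  rw [finrank_euclideanSpace_fin] at h
  exact h

theorem lintegral_comp_smul {l : ℝ} (hl : l ≠ 0) (f : Rd d → ℝ≥0∞) :
    ∫⁻ y, f (l • y) = ENNReal.ofReal |(l ^ d)⁻¹| * ∫⁻ y, f y := by
  have h := lintegral_map_equiv f (smulEquiv (d := d) hl) (μ := volume)
  rw [map_smulEquiv, lintegral_smul_measure] at h
  exact h.symm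

theorem quasiMeasurePreserving_smul {l : ℝ} (hl : l ≠ 0) :
    Measure.QuasiMeasurePreserving (fun y : Rd d => l • y) volume volume := by
  refine ⟨by fun_prop, ?_⟩
  have h := map_smulEquiv (d := d) hl
  change Measure.map (fun y : Rd d => l • y) volume = _ at h
  rw [h]
  exact Measure.smul_absolutelyContinuous

theorem coeFn_dilate {l : ℝ} (hl : l ≠ 0) (u : L2Rd d) :
    dilate l u =ᵐ[volume] fun y => ((|l| ^ ((d : ℝ) / 2) : ℝ) : ℂ) * u (l • y) := by
  rw [dilate, dif_pos hl]
  exact MemLp.coeFn_toLp _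

theorem rpow_half_sq (l : ℝ) : (|l| ^ ((d : ℝ) / 2)) ^ 2 = |l| ^ d := by
  rw [← Real.rpow_natCast, ← Real.rpow_mul (abs_nonneg l)]
  simp

theorem norm_dilate {l : ℝ} (hl : l ≠ 0) (u : L2Rd d) : ‖dilate l u‖ = ‖u‖ := by
  have h : ‖dilate l u‖ₑ ^ 2 = ‖u‖ₑ ^ 2 := by
    rw [dilate, dif_pos hl, enorm_toLp_sq, enorm_Lp_sq]
    simp only [enorm_mul, mul_pow]
    rw [lintegral_const_mul' _ _ (by simp), lintegral_comp_smul hl (fun y => ‖u y‖ₑ ^ 2),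
      ← mul_assoc]
    convert one_mul _
    rw [← ofReal_norm, ← ENNReal.ofReal_pow (norm_nonneg _), Complex.norm_real, Real.norm_eq_abs,
      sq_abs, rpow_half_sq, ← ENNReal.ofReal_mul (by positivity), abs_inv, abs_pow,
      mul_inv_cancel₀ (by positivity), ENNReal.ofReal_one]
  have h2 := congrArg ENNReal.toReal h
  simp only [ENNReal.toReal_pow, toReal_enorm] at h2
  exact (pow_left_inj₀ (norm_nonneg _) (norm_nonneg _) two_ne_zero).1 h2

theorem dilate_add {l : ℝ} (hl : l ≠ 0) (u v : L2Rd d) :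
    dilate l (u + v) = dilate l u + dilate l v := by
  refine Lp.ext ?_
  filter_upwards [coeFn_dilate hl (u + v), coeFn_dilate hl u, coeFn_dilate hl v,
    Lp.coeFn_add (dilate l u) (dilate l v),
    (quasiMeasurePreserving_smul hl).ae (Lp.coeFn_add u v)] with y h1 h2 h3 h4 h5
  rw [h1, h4, Pi.add_apply, h2, h3, h5, Pi.add_apply, mul_add]

theorem dilate_smul {l : ℝ} (hl : l ≠ 0) (c : ℂ) (u : L2Rd d) :
    dilate l (c • u) = c • dilate l u := by
  refine Lp.ext ?_
  filter_upwards [coeFn_dilate hl (c • u), coeFn_dilate hl u, Lp.coeFn_smul c (dilate l u),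
    (quasiMeasurePreserving_smul hl).ae (Lp.coeFn_smul c u)] with y h1 h2 h3 h4
  rw [h1, h3, Pi.smul_apply, h2, h4, Pi.smul_apply, smul_eq_mul, smul_eq_mul]
  ring

theorem dilate_dilate {l m : ℝ} (hl : l ≠ 0) (hlm : m * l = 1) (u : L2Rd d) :
    dilate l (dilate m u) = u := by
  have hm : m ≠ 0 := left_ne_zero_of_mul_eq_one hlm
  refine Lp.ext ?_
  filter_upwards [coeFn_dilate hl (dilate m u),
    (quasiMeasurePreserving_smul hl).ae (coeFn_dilate hm u)] with y h1 h2
  rw [h1, h2, smul_smul, hlm, one_smul, ← mul_assoc, ← Complex.ofReal_mul,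
    ← Real.mul_rpow (abs_nonneg _) (abs_nonneg _), ← abs_mul, mul_comm l, hlm]
  simp

/-- The normalized dilation as a unitary operator on `L²(ℝ^d)` (the identity for `l = 0`). -/
def dil (l : ℝ) : L2Rd d ≃ₗᵢ[ℂ] L2Rd d :=
  if hl : l ≠ 0 then
    { toFun := dilate l
      invFun := dilate l⁻¹
      map_add' := dilate_add hl
      map_smul' := dilate_smul hl
      left_inv := dilate_dilate (inv_ne_zero hl) (mul_inv_cancel₀ hl)
      right_inv := dilate_dilate hl (inv_mul_cancel₀ hl)
      norm_map' := norm_dilate hl }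
  else LinearIsometryEquiv.refl ℂ _

theorem dil_apply {l : ℝ} (hl : l ≠ 0) (u : L2Rd d) : dil l u = dilate l u := by
  rw [dil, dif_pos hl]
  rfl

/-! ### The dilated Schrödinger representations -/

/-- The factor `e^{2πi l t} e^{-2πi q·y}`, for `x = (p, q, t)`. -/
def twist (l : ℝ) (x : Heis d) (y : Rd d) : ℂ :=
  Complex.exp (2 * Real.pi * Complex.I * (l * x.t - inner ℝ x.q y : ℝ))

theorem norm_twist (l : ℝ) (x : Heis d) (y : Rd d) : ‖twist l x y‖ = 1 := by
  have : 2 * (Real.pi : ℂ) * Complex.I * (l * x.t - inner ℝ x.q y : ℝ)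
    = (2 * Real.pi * (l * x.t - inner ℝ x.q y) : ℝ) * Complex.I := by push_cast; ring
  rw [twist, this, Complex.norm_exp_ofReal_mul_I]

theorem phase_eq_twist (l : ℝ) (x : Heis d) (y : Rd d) : phase l x y = twist l x (l • y) := by
  rw [phase, twist, ← Complex.exp_add, inner_smul_right]
  congr 1
  push_cast
  ring

theorem continuous_twist : Continuous fun z : ℝ × Heis d × Rd d => twist z.1 z.2.1 z.2.2 := by
  unfold twist
  fun_prop

theorem memLp_twist_mul (l : ℝ) (x : Heis d) (v : L2Rd d) :
    MemLp (fun y => twist l x y * v (y - l • x.p)) 2 volume := by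
  have hv := (Lp.memLp v).comp_measurePreserving
    (measurePreserving_sub_right (volume : Measure (Rd d)) (l • x.p))
  refine MemLp.of_le hv (AEStronglyMeasurable.mul ?_ hv.1)
    (Eventually.of_forall fun y => by simp [norm_twist])
  exact (continuous_twist.comp (by fun_prop :
    Continuous fun y : Rd d => (l, x, y))).aestronglyMeasurable

/-- The representation `(σ_l(p, q, t) v)(y) = e^{2πi l t} e^{-2πi q·y} v(y - l p)`, which is the
conjugate of the Schrödinger representation by the dilation. -/
def dilatedSchrodinger (l : ℝ) (x : Heis d) (v : L2Rd d) : L2Rd d := (memLp_twist_mul l x v).toLp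

theorem coeFn_schrodinger (l : ℝ) (x : Heis d) (f : L2Rd d) :
    schrodinger l x f =ᵐ[volume] fun y => phase l x y * f (y - x.p) :=
  MemLp.coeFn_toLp (memLp_schrodinger l x f)

/-- The phase depends on `y` only through `l y`, so after the dilation the modulation no longer
involves `l`, while translation by `p` becomes translation by `l p`. -/
theorem schrodinger_dil {l : ℝ} (hl : l ≠ 0) (x : Heis d) (v : L2Rd d) :
    schrodinger l x (dil l v) = dil l (dilatedSchrodinger l x v) := by
  rw [dil_apply hl, dil_apply hl]
  refine Lp.ext ?_
  filter_upwards [coeFn_schrodinger l x (dilate l v),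
    coeFn_dilate hl (dilatedSchrodinger l x v),
    (quasiMeasurePreserving_smul hl).ae (memLp_twist_mul l x v).coeFn_toLp,
    (measurePreserving_sub_right volume x.p).quasiMeasurePreserving.ae (coeFn_dilate hl v)]
    with y h1 h2 h3 h4
  rw [h1, h2, h4, dilatedSchrodinger, h3, phase_eq_twist, smul_sub]
  ring

/-- The operator `T`, conjugated by the dilation on the left and by the dilation and the Fourier
transform on the right. -/
def model (l : ℝ) (T : L2Rd d →L[ℂ] L2Rd d) : L2Rd d →L[ℂ] L2Rd d :=
  (dil l).symm.toLinearIsometry.toContinuousLinearMap ∘L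
    (T ∘L ((Lp.fourierTransformₗᵢ (Rd d) ℂ).symm.trans
      (dil l)).toContinuousLinearEquiv.toContinuousLinearMap)

theorem model_apply (l : ℝ) (T : L2Rd d →L[ℂ] L2Rd d) (g : L2Rd d) :
    model l T g = (dil l).symm (T (dil l ((Lp.fourierTransformₗᵢ (Rd d) ℂ).symm g))) := rfl

theorem inner_model (l : ℝ) (T : L2Rd d →L[ℂ] L2Rd d) (f g : L2Rd d) :
    inner ℂ f (model l T g)
      = inner ℂ (dil l f) (T (dil l ((Lp.fourierTransformₗᵢ (Rd d) ℂ).symm g))) := by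
  rw [model_apply, ← (dil l).inner_map_map f, LinearIsometryEquiv.apply_symm_apply]

theorem hsNormSq_model (l : ℝ) (T : L2Rd d →L[ℂ] L2Rd d) :
    hsNormSq (model l T) = hsNormSq T := by
  rw [model, hsNormSq_comp_isometry, hsNormSq_comp_equiv]

theorem model_sub (l : ℝ) (T S : L2Rd d →L[ℂ] L2Rd d) :
    model l (T - S) = model l T - model l S := by
  ext1 g
  simp only [model_apply, _root_.sub_apply, map_sub]

/-! ### The kernel of the Fourier transform of an integrable function -/

/-- `e^{2πi y·ξ}`. -/
def chirp (z : Rd d × Rd d) : ℂ := Complex.exp (2 * Real.pi * Complex.I * (inner ℝ z.1 z.2 : ℝ))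

theorem norm_chirp (z : Rd d × Rd d) : ‖chirp z‖ = 1 := by
  have : 2 * (Real.pi : ℂ) * Complex.I * (inner ℝ z.1 z.2 : ℝ)
    = (2 * Real.pi * inner ℝ z.1 z.2 : ℝ) * Complex.I := by push_cast; ring
  rw [chirp, this, Complex.norm_exp_ofReal_mul_I]

@[fun_prop] theorem continuous_chirp : Continuous (chirp : Rd d × Rd d → ℂ) := by
  unfold chirp
  fun_prop

/-- The character `x ↦ e^{-2πi (l p·ξ + q·y - l t)}`, `x = (p, q, t)`. -/
def heisChar (l : ℝ) (z : Rd d × Rd d) (x : Heis d) : ℂ :=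
  Complex.exp (-(2 * Real.pi * Complex.I *
    (inner ℝ x.p (l • z.2) + inner ℝ x.q z.1 - l * x.t : ℝ)))

theorem norm_heisChar (l : ℝ) (z : Rd d × Rd d) (x : Heis d) : ‖heisChar l z x‖ = 1 := by
  have : -(2 * (Real.pi : ℂ) * Complex.I *
      (inner ℝ x.p (l • z.2) + inner ℝ x.q z.1 - l * x.t : ℝ))
    = (-(2 * Real.pi * (inner ℝ x.p (l • z.2) + inner ℝ x.q z.1 - l * x.t)) : ℝ)
      * Complex.I := by push_cast; ring
  rw [heisChar, this, Complex.norm_exp_ofReal_mul_I]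

theorem continuous_heisChar (l : ℝ) :
    Continuous fun w : Heis d × (Rd d × Rd d) => heisChar l w.2 w.1 := by
  unfold heisChar
  fun_prop

-- Writing `𝓕⁻ g` as an integral turns the translation by `l p` into the factor `e^{-2πi l p·ξ}`.
-- All dependence on `x` is then in the character `heisChar`, and what remains is the fixed
-- unimodular factor `chirp`.
open FourierTransform SchwartzMap in
theorem inner_schrodinger_schwartz {l : ℝ} (hl : l ≠ 0) (x : Heis d) (f g : 𝓢(Rd d, ℂ)) :
    inner ℂ (dil l (f.toLp 2)) (schrodinger l x
      (dil l ((Lp.fourierTransformₗᵢ (Rd d) ℂ).symm (g.toLp 2))))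
      = ∫ z : Rd d × Rd d, (starRingEnd ℂ) (f z.1) * (chirp z * heisChar l z x) * g z.2 := by
  have hv : (Lp.fourierTransformₗᵢ (Rd d) ℂ).symm (g.toLp 2) = (𝓕⁻ g).toLp 2 :=
    toLp_fourierInv_eq g
  have hi : Integrable (fun z : Rd d × Rd d =>
      (starRingEnd ℂ) (f z.1) * (chirp z * heisChar l z x) * g z.2)
      ((volume : Measure (Rd d)).prod volume) := by
    have h := f.integrable (μ := volume) |>.norm.mul_prod (g.integrable (μ := volume)).norm
    refine h.mono' ?_ (Eventually.of_forall fun z => ?_)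
    · refine Continuous.aestronglyMeasurable ?_
      have := (continuous_heisChar (d := d) l).comp
        (by fun_prop : Continuous fun z : Rd d × Rd d => (x, z))
      have h1 := f.continuous
      have h2 := g.continuous
      have h3 := Complex.continuous_conj
      exact ((h3.comp (h1.comp continuous_fst)).mul (continuous_chirp.mul this)).mul
        (h2.comp continuous_snd)
    · simp [norm_chirp, norm_heisChar]
  rw [hv, schrodinger_dil hl, LinearIsometryEquiv.inner_map_map, Measure.volume_eq_prod,
    integral_prod _ hi, inner_Lp]
  refine integral_congr_ae ?_
  filter_upwards [f.coeFn_toLp 2 volume, (memLp_twist_mul l x ((𝓕⁻ g).toLp 2)).coeFn_toLp,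
    (measurePreserving_sub_right volume (l • x.p)).quasiMeasurePreserving.ae
      ((𝓕⁻ g).coeFn_toLp 2 volume)] with y h1 h2 h3
  rw [h1, dilatedSchrodinger, h2, h3, fourierInv_coe, Real.fourierInv_eq', ← integral_const_mul,
    ← integral_const_mul]
  refine integral_congr_ae (Eventually.of_forall fun ξ => ?_)
  simp only [smul_eq_mul, mul_assoc]
  congr 1
  rw [← mul_assoc, ← mul_assoc (chirp _)]
  congr 1
  rw [twist, chirp, heisChar, ← Complex.exp_add, ← Complex.exp_add]
  congr 1
  simp only [inner_sub_right, inner_smul_right, real_inner_comm ξ]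
  push_cast
  ring

/-- Schwartz functions are integrable, so the integrals over `x` and `z` converge jointly and Fubini
moves the integral over the group inside. The inner integral is the Euclidean Fourier transform of
`φ`. -/
theorem inner_fourierOp_schwartz {l : ℝ} (hl : l ≠ 0) {φ : Heis d → ℂ} (hφ : Integrable φ)
    (f g : SchwartzMap (Rd d) ℂ) :
    inner ℂ (f.toLp 2 volume : L2Rd d) (model l (fourierOp hφ l) (g.toLp 2 volume : L2Rd d))
      = ∫ z : Rd d × Rd d, (starRingEnd ℂ) (f z.1)
          * (chirp z * ∫ x, φ x * heisChar l z x) * g z.2 := by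
  have h1 : inner ℂ (f.toLp 2 volume : L2Rd d) (model l (fourierOp hφ l) (g.toLp 2 volume : L2Rd d))
      = ∫ x, φ x * ∫ z : Rd d × Rd d,
        (starRingEnd ℂ) (f z.1) * (chirp z * heisChar l z x) * g z.2 := by
    rw [inner_model]
    change inner ℂ _ (∫ x, φ x • schrodinger l x _) = _
    rw [← integral_inner (integrable_smul_schrodinger l hφ _)]
    refine integral_congr_ae (Eventually.of_forall fun x => ?_)
    simp only
    rw [inner_smul_right, inner_schrodinger_schwartz hl]
  have hi : Integrable (fun w : Heis d × (Rd d × Rd d) =>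
      φ w.1 * ((starRingEnd ℂ) (f w.2.1) * (chirp w.2 * heisChar l w.2 w.1) * g w.2.2))
      ((volume : Measure (Heis d)).prod (volume : Measure (Rd d × Rd d))) := by
    have h := hφ.norm.mul_prod
      ((f.integrable (μ := volume)).norm.mul_prod (g.integrable (μ := volume)).norm)
    have c1 : Continuous fun w : Heis d × (Rd d × Rd d) => (starRingEnd ℂ) (f w.2.1) :=
      Complex.continuous_conj.comp (f.continuous.comp (continuous_fst.comp continuous_snd))
    have c2 : Continuous fun w : Heis d × (Rd d × Rd d) => chirp w.2 * heisChar l w.2 w.1 :=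
      (continuous_chirp.comp continuous_snd).mul (continuous_heisChar l)
    have c3 : Continuous fun w : Heis d × (Rd d × Rd d) => g w.2.2 :=
      g.continuous.comp (continuous_snd.comp continuous_snd)
    have c4 := ((c1.mul c2).mul c3).aestronglyMeasurable
      (μ := (volume : Measure (Heis d)).prod (volume : Measure (Rd d × Rd d)))
    exact h.mono' (hφ.1.comp_fst.mul c4)
      (Eventually.of_forall fun w => by simp [norm_chirp, norm_heisChar])
  rw [h1]
  simp_rw [← integral_const_mul]
  rw [integral_integral_swap hi]
  refine integral_congr_ae (Eventually.of_forall fun z => ?_)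
  simp only
  rw [← integral_mul_const]
  refine integral_congr_ae (Eventually.of_forall fun x => ?_)
  simp only
  ring

end Dilation

section Plancherel

variable {d : ℕ}

/-! ### The frequency space -/

/-- `ℝ^d × ℝ^d × ℝ` with its Euclidean structure. -/
abbrev Freq (d : ℕ) : Type := WithLp 2 (Rd d × WithLp 2 (Rd d × ℝ))

/-- The identification of the Euclidean space `ℝ^{2d+1}` with the Heisenberg group. -/
def ofFreq (w : Freq d) : Heis d :=
  Heis.mk (WithLp.ofLp w).1 (WithLp.ofLp (WithLp.ofLp w).2).1 (WithLp.ofLp (WithLp.ofLp w).2).2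

/-- The identification of the Heisenberg group with the Euclidean space `ℝ^{2d+1}`. -/
def toFreq (x : Heis d) : Freq d := WithLp.toLp 2 (x.p, WithLp.toLp 2 (x.q, x.t))

theorem toFreq_ofFreq (w : Freq d) : toFreq (ofFreq w) = w := rfl

theorem measurePreserving_prodToFreq :
    MeasurePreserving (fun z : Rd d × (Rd d × ℝ) =>
      (WithLp.toLp 2 (z.1, WithLp.toLp 2 z.2) : Freq d)) volume volume := by
  have h := (MeasurePreserving.id (volume : Measure (Rd d))).prod
    (WithLp.volume_preserving_toLp (Rd d) ℝ)
  exact (WithLp.volume_preserving_toLp (Rd d) (WithLp 2 (Rd d × ℝ))).comp h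

theorem measurePreserving_toFreq : MeasurePreserving (toFreq : Heis d → Freq d) :=
  measurePreserving_prodToFreq

theorem measurePreserving_ofFreq : MeasurePreserving (ofFreq : Freq d → Heis d) := by
  have h := (MeasurePreserving.id (volume : Measure (Rd d))).prod
    (WithLp.volume_preserving_ofLp (Rd d) ℝ)
  exact h.comp (WithLp.volume_preserving_ofLp (Rd d) (WithLp 2 (Rd d × ℝ)))

/-- `L²(ℍ^d)` as a space of functions on the Euclidean space `ℝ^{2d+1}`. -/
def transport : L2Heis d →ₗᵢ[ℂ] Lp (α := Freq d) ℂ 2 :=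
  Lp.compMeasurePreservingₗᵢ ℂ ofFreq measurePreserving_ofFreq

theorem coeFn_transport (ψ : L2Heis d) :
    transport ψ =ᵐ[volume] fun w => ψ (ofFreq w) :=
  Lp.coeFn_compMeasurePreserving ψ measurePreserving_ofFreq

theorem transport_surjective : Function.Surjective (transport : L2Heis d → _) := by
  intro χ
  refine ⟨Lp.compMeasurePreserving toFreq measurePreserving_toFreq χ, Lp.ext ?_⟩
  filter_upwards [coeFn_transport (Lp.compMeasurePreserving toFreq measurePreserving_toFreq χ),
    measurePreserving_ofFreq.quasiMeasurePreserving.ae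
      (Lp.coeFn_compMeasurePreserving χ measurePreserving_toFreq)] with w h1 h2
  rw [h1, h2, Function.comp_apply, toFreq_ofFreq]

/-! ### The space of kernels -/

/-- The Plancherel measure `|l|^d dl`. -/
def plancherel (d : ℕ) : Measure ℝ := volume.withDensity fun l => ENNReal.ofReal (|l| ^ d)

instance : SigmaFinite (plancherel d) := SigmaFinite.withDensity_ofReal _

theorem measurable_density : Measurable fun l : ℝ => ENNReal.ofReal (|l| ^ d) := by
  fun_prop

/-- The density is positive away from the null set `{0}`. -/
theorem ae_of_ae_plancherel {p : ℝ → Prop} (h : ∀ᵐ l ∂plancherel d, p l) : ∀ᵐ l : ℝ, p l := by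
  rw [plancherel, ae_withDensity_iff measurable_density] at h
  filter_upwards [h, Measure.ae_ne volume (0 : ℝ)] with l hl h0
  refine hl ?_
  have : 0 < |l| ^ d := by positivity
  simpa only [ne_eq, ENNReal.ofReal_eq_zero, not_le] using this

/-- The map `(l, y, ξ) ↦ (l ξ, y, -l)`. -/
def freqMap (w : ℝ × (Rd d × Rd d)) : Freq d :=
  WithLp.toLp 2 (w.1 • w.2.2, WithLp.toLp 2 (w.2.1, -w.1))

/-- For fixed `l ≠ 0` the substitution `ξ ↦ l ξ` contributes `|l|^{-d}`, which cancels the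
Plancherel density. This is where the weight of the Heisenberg Plancherel formula comes from. -/
theorem measurePreserving_freqMap :
    MeasurePreserving (freqMap (d := d)) ((plancherel d).prod volume) volume := by
  have h : MeasurePreserving (fun w : ℝ × (Rd d × Rd d) => (w.1 • w.2.2, (w.2.1, -w.1)))
      ((plancherel d).prod volume) (volume : Measure (Rd d × (Rd d × ℝ))) := by
    have hm : Measurable (fun w : ℝ × (Rd d × Rd d) => (w.1 • w.2.2, (w.2.1, -w.1))) :=
      Continuous.measurable (by fun_prop)
    refine ⟨hm, Measure.ext_of_lintegral _ fun f hf => ?_⟩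
    have hi : Measurable fun l : ℝ => ∫⁻ z : Rd d × Rd d, f (l • z.2, (z.1, -l)) :=
      Measurable.lintegral_prod_right' (f := fun w : ℝ × (Rd d × Rd d) =>
        f (w.1 • w.2.2, (w.2.1, -w.1))) (hf.comp hm)
    have hs : ∀ l : ℝ, l ≠ 0 → ENNReal.ofReal (|l| ^ d) *
        ∫⁻ z : Rd d × Rd d, f (l • z.2, (z.1, -l))
          = ∫⁻ y : Rd d, ∫⁻ ξ : Rd d, f (ξ, (y, -l)) := by
      intro l hl
      have h1 : Measurable fun z : Rd d × Rd d => f (l • z.2, (z.1, -l)) :=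
        hf.comp (Continuous.measurable (by fun_prop))
      rw [Measure.volume_eq_prod, lintegral_prod _ h1.aemeasurable]
      simp_rw [fun y : Rd d => lintegral_comp_smul hl fun ξ => f (ξ, (y, -l))]
      rw [lintegral_const_mul' _ _ (by simp), ← mul_assoc, ← ENNReal.ofReal_mul (by positivity),
        abs_inv, abs_pow, mul_inv_cancel₀ (by positivity), ENNReal.ofReal_one, one_mul]
    rw [lintegral_map hf hm, lintegral_prod (fun w : ℝ × (Rd d × Rd d) =>
      f (w.1 • w.2.2, (w.2.1, -w.1))) (hf.comp hm).aemeasurable, plancherel,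
      lintegral_withDensity_eq_lintegral_mul _ measurable_density hi]
    have h2 : ∫⁻ l : ℝ, ((fun l => ENNReal.ofReal (|l| ^ d)) *
        fun l => ∫⁻ z : Rd d × Rd d, f (l • z.2, (z.1, -l))) l
        = ∫⁻ l : ℝ, ∫⁻ y : Rd d, ∫⁻ ξ : Rd d, f (ξ, (y, -l)) := by
      refine lintegral_congr_ae ?_
      filter_upwards [Measure.ae_ne volume (0 : ℝ)] with l hl
      exact hs l hl
    rw [h2, lintegral_neg_eq_self (fun l : ℝ => ∫⁻ y : Rd d, ∫⁻ ξ : Rd d, f (ξ, (y, l)))]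
    rw [Measure.volume_eq_prod (Rd d) (Rd d × ℝ), lintegral_prod_symm _ hf.aemeasurable,
      Measure.volume_eq_prod (Rd d) ℝ,
      lintegral_prod_symm _ (Measurable.lintegral_prod_left' hf).aemeasurable]
  exact measurePreserving_prodToFreq.comp h

/-- The square integrable kernels on `ℝ* × ℝ^d × ℝ^d`. -/
abbrev KernelSpace (d : ℕ) : Type :=
  Lp ℂ 2 ((plancherel d).prod (volume : Measure (Rd d × Rd d)))

/-- The Fourier transform of `L²(ℍ^d)`, realized as a space of kernels. -/
def kernelTransform : L2Heis d →ₗᵢ[ℂ] KernelSpace d :=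
  (Lp.compMeasurePreservingₗᵢ ℂ freqMap measurePreserving_freqMap).comp
    ((Lp.fourierTransformₗᵢ (Freq d) ℂ).toLinearIsometry.comp transport)

theorem coeFn_kernelTransform (ψ : L2Heis d) :
    kernelTransform ψ =ᵐ[(plancherel d).prod volume]
      fun w => (Lp.fourierTransformₗᵢ (Freq d) ℂ (transport ψ)) (freqMap w) :=
  Lp.coeFn_compMeasurePreserving _ measurePreserving_freqMap

/-- `K` is the kernel of the operator field `H`. -/
def HasFieldKernel (H : ℝ → L2Rd d →L[ℂ] L2Rd d) (K : ℝ × (Rd d × Rd d) → ℂ) : Prop :=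
  ∀ᵐ l : ℝ, HasKernel (model l (H l)) fun z => chirp z * K (l, z)

theorem memLp_chirp_mul {K : Rd d × Rd d → ℂ} (hK : MemLp K 2 volume) :
    MemLp (fun z => chirp z * K z) 2 ((volume : Measure (Rd d)).prod volume) :=
  hK.of_le (continuous_chirp.aestronglyMeasurable.mul hK.1)
    (Eventually.of_forall fun z => by simp [norm_chirp])

theorem ae_memLp_fieldKernel {K : ℝ × (Rd d × Rd d) → ℂ}
    (hK : MemLp K 2 ((plancherel d).prod volume)) :
    ∀ᵐ l : ℝ, MemLp (fun z => chirp z * K (l, z)) 2 ((volume : Measure (Rd d)).prod volume) := by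
  filter_upwards [ae_of_ae_plancherel (ae_memLp_section hK)] with l hl
  exact memLp_chirp_mul hl

theorem HasFieldKernel.sub {H H' : ℝ → L2Rd d →L[ℂ] L2Rd d} {K K' : ℝ × (Rd d × Rd d) → ℂ}
    (h : HasFieldKernel H K) (h' : HasFieldKernel H' K')
    (hK : MemLp K 2 ((plancherel d).prod volume)) (hK' : MemLp K' 2 ((plancherel d).prod volume)) :
    HasFieldKernel (fun l => H l - H' l) (K - K') := by
  filter_upwards [h, h', ae_memLp_fieldKernel hK, ae_memLp_fieldKernel hK'] with l h1 h2 h3 h4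
  rw [model_sub]
  convert h1.sub h2 h3 h4 using 1
  funext z
  simp only [Pi.sub_apply, mul_sub]

/-- The Hilbert-Schmidt norm of an operator field is the norm of its kernel. -/
theorem fieldNormSq_eq_lintegral {H : ℝ → L2Rd d →L[ℂ] L2Rd d} {K : ℝ × (Rd d × Rd d) → ℂ}
    (h : HasFieldKernel H K) (hK : MemLp K 2 ((plancherel d).prod volume)) :
    fieldNormSq H = ∫⁻ w, ‖K w‖ₑ ^ 2 ∂((plancherel d).prod volume) := by
  have hm : AEMeasurable (fun w => ‖K w‖ₑ ^ 2) ((plancherel d).prod volume) :=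
    hK.1.enorm.pow_const 2
  rw [lintegral_prod _ hm, plancherel,
    lintegral_withDensity_eq_lintegral_mul₀' measurable_density.aemeasurable
      hm.lintegral_prod_right']
  refine lintegral_congr_ae ?_
  filter_upwards [h, ae_memLp_fieldKernel hK] with l h1 h2
  have : TopologicalSpace.SeparableSpace (L2Rd d) :=
    haveI : Fact ((2 : ℝ≥0∞) ≠ ∞) := ⟨by simp⟩
    inferInstance
  rw [Pi.mul_apply, mul_comm, ← hsNormSq_model l, hsNormSq_eq_lintegral h2 h1]
  congr 1
  refine lintegral_congr fun z => ?_
  rw [enorm_mul, ← ofReal_norm (chirp z), norm_chirp, ENNReal.ofReal_one, one_mul]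

/-! ### The group Fourier transform expressed by the Euclidean one -/

theorem fourier_transport {φ : L2Heis d} (hφ : Integrable φ) (l : ℝ) (z : Rd d × Rd d) :
    FourierTransform.fourier (transport φ : Freq d → ℂ) (freqMap (l, z))
      = ∫ x, φ x * heisChar l z x := by
  have h1 : AEStronglyMeasurable (fun x : Heis d => φ x * heisChar l z x) volume :=
    hφ.1.mul ((continuous_heisChar l).comp (by fun_prop :
      Continuous fun x : Heis d => (x, z))).aestronglyMeasurable
  have h2 : ∫ x, φ x * heisChar l z x
      = ∫ w : Freq d, φ (ofFreq w) * heisChar l z (ofFreq w) := by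
    have h3 := measurePreserving_ofFreq (d := d)
    exact (congrArg (fun m : Measure (Heis d) => ∫ x, φ x * heisChar l z x ∂m)
      h3.map_eq).symm.trans
      (integral_map h3.measurable.aemeasurable (by rw [h3.map_eq]; exact h1))
  rw [h2, Real.fourier_eq']
  refine integral_congr_ae ?_
  filter_upwards [coeFn_transport φ] with w hw
  rw [hw, smul_eq_mul, mul_comm]
  congr 1
  rw [heisChar]
  congr 1
  simp only [freqMap, ofFreq, Heis.p_mk, Heis.q_mk, Heis.t_mk, WithLp.prod_inner_apply]
  simp
  ring

open SchwartzMap in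
theorem hasFieldKernel_fourierOp {φ : L2Heis d} (hφ : Integrable φ) :
    HasFieldKernel (fourierOp hφ) (kernelTransform φ) := by
  have hi : Integrable (transport φ : Freq d → ℂ) :=
    (measurePreserving_ofFreq.integrable_comp_of_integrable hφ).congr (coeFn_transport φ).symm
  have h1 : ∀ᵐ w ∂((plancherel d).prod (volume : Measure (Rd d × Rd d))),
      kernelTransform φ w = ∫ x, φ x * heisChar w.1 w.2 x := by
    filter_upwards [coeFn_kernelTransform φ,
      measurePreserving_freqMap.quasiMeasurePreserving.ae (fourier_Lp_ae_eq _ hi)] with w h2 h3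
    rw [h2, h3]
    exact fourier_transport hφ w.1 w.2
  filter_upwards [ae_of_ae_plancherel (Measure.ae_ae_of_ae_prod h1),
    ae_memLp_fieldKernel (Lp.memLp (kernelTransform φ)), Measure.ae_ne volume (0 : ℝ)]
    with l h2 h3 hl
  refine hasKernel_of_dense h3 (SchwartzMap.denseRange_toLpCLM ENNReal.ofNat_ne_top) ?_
  rintro _ ⟨f, rfl⟩ _ ⟨g, rfl⟩
  refine (inner_fourierOp_schwartz hl hφ f g).trans ?_
  refine integral_congr_ae ?_
  filter_upwards [h2, Measure.quasiMeasurePreserving_fst.ae (f.coeFn_toLp 2 volume),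
    Measure.quasiMeasurePreserving_snd.ae (g.coeFn_toLp 2 volume)] with z h4 h5 h6
  rw [h4]
  simp only [toLpCLM_apply, h5, h6]

/-- This translates the convergence of operator fields in the definition of the Fourier transform
into norm convergence of kernels. -/
theorem fieldNormSq_fourierOp_sub {φ : L2Heis d} (hφ : Integrable φ)
    {H : ℝ → L2Rd d →L[ℂ] L2Rd d} {G : KernelSpace d} (h : HasFieldKernel H G) :
    fieldNormSq (fun l => fourierOp hφ l - H l) = ‖kernelTransform φ - G‖ₑ ^ 2 := by
  have hs := (hasFieldKernel_fourierOp hφ).sub h (Lp.memLp _) (Lp.memLp _)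
  rw [fieldNormSq_eq_lintegral hs ((Lp.memLp _).sub (Lp.memLp _)), enorm_Lp_sq]
  refine lintegral_congr_ae ?_
  filter_upwards [Lp.coeFn_sub (kernelTransform φ) G] with w hw
  rw [hw]

/-- `ψ` is the limit of integrable functions whose Fourier transforms converge to `H`. -/
def IsFourierLimit (ψ : L2Heis d) (H : ℝ → L2Rd d →L[ℂ] L2Rd d) : Prop :=
  ∃ (φ : ℕ → L2Heis d) (hφ : ∀ n, Integrable (φ n)), Tendsto φ atTop (𝓝 ψ) ∧
    Tendsto (fun n => fieldNormSq fun l => fourierOp (hφ n) l - H l) atTop (𝓝 0)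

theorem tendsto_enorm_sq_zero_iff {E : Type*} [SeminormedAddCommGroup E] {x : ℕ → E} :
    Tendsto (fun n => ‖x n‖ₑ ^ 2) atTop (𝓝 0) ↔ Tendsto x atTop (𝓝 0) := by
  rw [tendsto_zero_iff_norm_tendsto_zero]
  constructor
  · intro h
    have h1 := ((ENNReal.continuous_rpow_const (y := (1 / 2 : ℝ))).tendsto 0).comp h
    rw [ENNReal.zero_rpow_of_pos (by norm_num)] at h1
    have h2 := (ENNReal.tendsto_toReal ENNReal.zero_ne_top).comp h1
    refine h2.congr fun n => ?_
    simp only [Function.comp_apply]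
    rw [← ENNReal.rpow_natCast, ← ENNReal.rpow_mul]
    norm_num
  · intro h
    have h1 := ENNReal.tendsto_ofReal (h.pow 2)
    simpa [ENNReal.ofReal_pow] using h1

theorem IsFourierLimit.kernelTransform_eq {ψ : L2Heis d} {H : ℝ → L2Rd d →L[ℂ] L2Rd d}
    (hψ : IsFourierLimit ψ H) {G : KernelSpace d} (h : HasFieldKernel H G) :
    kernelTransform ψ = G := by
  obtain ⟨φ, hφ, h1, h2⟩ := hψ
  simp_rw [fieldNormSq_fourierOp_sub _ h, tendsto_enorm_sq_zero_iff] at h2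
  exact tendsto_nhds_unique ((kernelTransform.continuous.tendsto ψ).comp h1)
    (tendsto_sub_nhds_zero_iff.1 h2)

theorem exists_integrable_tendsto (ψ : L2Heis d) :
    ∃ φ : ℕ → L2Heis d, (∀ n, Integrable (φ n)) ∧ Tendsto φ atTop (𝓝 ψ) := by
  have hd : Dense {φ : L2Heis d | Integrable φ} := by
    -- A square integrable simple function has support of finite measure, hence is integrable.
    refine (Lp.simpleFunc.dense (E := ℂ) (μ := (volume : Measure (Heis d)))
      (ENNReal.ofNat_ne_top : (2 : ℝ≥0∞) ≠ ∞)).mono fun φ hφ => ?_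
    have h1 := Lp.simpleFunc.memLp (⟨φ, hφ⟩ : Lp.simpleFunc ℂ 2 (volume : Measure (Heis d)))
    rw [SimpleFunc.memLp_iff_integrable (by norm_num) (by norm_num)] at h1
    exact h1.congr (Lp.simpleFunc.toSimpleFunc_eq_toFun _)
  obtain ⟨φ, h1, h2⟩ := mem_closure_iff_seq_limit.1 (hd ψ)
  exact ⟨φ, h1, h2⟩

theorem isFourierLimit_of_kernelTransform_eq {ψ : L2Heis d} {H : ℝ → L2Rd d →L[ℂ] L2Rd d}
    {G : KernelSpace d} (h : HasFieldKernel H G) (hψ : kernelTransform ψ = G) :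
    IsFourierLimit ψ H := by
  obtain ⟨φ, hφ, h1⟩ := exists_integrable_tendsto ψ
  refine ⟨φ, hφ, h1, ?_⟩
  simp_rw [fieldNormSq_fourierOp_sub _ h, tendsto_enorm_sq_zero_iff]
  refine tendsto_sub_nhds_zero_iff.2 ?_
  rw [← hψ]
  exact (kernelTransform.continuous.tendsto ψ).comp h1

end Plancherel

/-! ### Surjectivity of the kernel transform -/

section Surjectivity

variable {d : ℕ}

/-- The inverse of `freqMap` away from `l = 0`. -/
def freqInv (w : Freq d) : ℝ × (Rd d × Rd d) :=
  let x := ofFreq w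
  (-x.t, (x.q, (-x.t)⁻¹ • x.p))

theorem freqInv_freqMap {w : ℝ × (Rd d × Rd d)} (hw : w.1 ≠ 0) : freqInv (freqMap w) = w := by
  simp [freqInv, freqMap, ofFreq, smul_smul, inv_mul_cancel₀ hw]

theorem measurable_freqInv : Measurable (freqInv (d := d)) := by
  have h1 : Measurable (fun x : Heis d => (-x.t, (x.q, (-x.t)⁻¹ • x.p))) := by
    have hp := (Heis.continuous_p (d := d)).measurable
    have hq := (Heis.continuous_q (d := d)).measurable
    have ht := (Heis.continuous_t (d := d)).measurable
    exact ht.neg.prodMk (hq.prodMk (ht.neg.inv.smul hp))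
  exact h1.comp measurePreserving_ofFreq.measurable

theorem ae_plancherel_prod_ne_zero :
    ∀ᵐ w ∂((plancherel d).prod (volume : Measure (Rd d × Rd d))), w.1 ≠ 0 := by
  refine Measure.quasiMeasurePreserving_fst.ae (p := fun l : ℝ => l ≠ 0) ?_
  exact (withDensity_absolutelyContinuous _ _).ae_le (Measure.ae_ne volume (0 : ℝ))

/-- Of the three isometries composed in `kernelTransform`, two are known to be onto; the third is
composition with `freqMap`, which is inverted by `freqInv` off the null set `l = 0`. -/
theorem kernelTransform_surjective : Function.Surjective (kernelTransform (d := d)) := by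
  intro K
  have h1 : (fun w => K (freqInv (freqMap w))) =ᵐ[(plancherel d).prod volume] K := by
    filter_upwards [ae_plancherel_prod_ne_zero] with w hw
    rw [freqInv_freqMap hw]
  have hm : StronglyMeasurable fun w : Freq d => K (freqInv w) :=
    (Lp.stronglyMeasurable K).comp_measurable measurable_freqInv
  have h2 : MemLp (fun w : Freq d => K (freqInv w)) 2 volume := by
    rw [← (measurePreserving_freqMap (d := d)).map_eq,
      memLp_map_measure_iff hm.aestronglyMeasurable measurePreserving_freqMap.aemeasurable]
    exact (memLp_congr_ae h1).2 (Lp.memLp K)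
  obtain ⟨ψ, hψ⟩ := transport_surjective ((Lp.fourierTransformₗᵢ (Freq d) ℂ).symm h2.toLp)
  refine ⟨ψ, Lp.ext ?_⟩
  have h3 := coeFn_kernelTransform ψ
  rw [hψ, LinearIsometryEquiv.apply_symm_apply] at h3
  filter_upwards [h1, h3,
    measurePreserving_freqMap.quasiMeasurePreserving.ae h2.coeFn_toLp] with w h4 h5 h6
  rw [h5, h6, h4]

end Surjectivity

section Translation

variable {d : ℕ}

/-! ### Translations -/

theorem phase_mul (l : ℝ) (g x : Heis d) (y : Rd d) :
    phase l (g * x) y = phase l g y * phase l x (y - g.p) := by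
  simp only [phase, ← Complex.exp_add, Heis.mul_def, Heis.q_mk, Heis.t_mk]
  congr 1
  rw [inner_sub_right, inner_add_left, real_inner_comm x.q g.p]
  push_cast
  ring

theorem schrodinger_mul (l : ℝ) (g x : Heis d) (f : L2Rd d) :
    schrodinger l (g * x) f = schrodinger l g (schrodinger l x f) := by
  refine Lp.ext ?_
  filter_upwards [coeFn_schrodinger l (g * x) f, coeFn_schrodinger l g (schrodinger l x f),
    (measurePreserving_sub_right volume g.p).quasiMeasurePreserving.ae
      (coeFn_schrodinger l x f)] with y h1 h2 h3
  rw [h1, h2, h3, phase_mul, mul_assoc, sub_sub]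
  rfl

theorem schrodinger_one (l : ℝ) (f : L2Rd d) : schrodinger l 1 f = f := by
  refine Lp.ext ?_
  filter_upwards [coeFn_schrodinger l 1 f] with y h1
  rw [h1, Heis.one_def]
  simp [phase]

theorem coeFn_leftTranslation (g : Heis d) (φ : L2Heis d) :
    leftTranslation g φ =ᵐ[volume] fun x => φ (g⁻¹ * x) :=
  Lp.coeFn_compMeasurePreserving φ (Heis.measurePreserving_mul_left g⁻¹)

theorem integrable_leftTranslation (g : Heis d) {φ : L2Heis d} (hφ : Integrable φ) :
    Integrable (leftTranslation g φ) :=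
  ((Heis.measurePreserving_mul_left g⁻¹).integrable_comp_of_integrable hφ).congr
    (coeFn_leftTranslation g φ).symm

/-- Substitute `x ↦ g x`, which preserves the measure, and use `π_l(g x) = π_l(g) π_l(x)`. -/
theorem fourierOp_leftTranslation (g : Heis d) {φ : L2Heis d} (hφ : Integrable φ) (l : ℝ) :
    fourierOp (integrable_leftTranslation g hφ) l
      = (schrodinger l g).toContinuousLinearMap ∘L fourierOp hφ l := by
  ext1 f
  change ∫ x, (leftTranslation g φ) x • schrodinger l x f
    = schrodinger l g (∫ x, φ x • schrodinger l x f)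
  have h1 := (integrable_smul_schrodinger l (integrable_leftTranslation g hφ) f).1
  have hg := Heis.measurePreserving_mul_left g
  have h2 : ∫ x, (leftTranslation g φ) x • schrodinger l x f
      = ∫ x, (leftTranslation g φ) (g * x) • schrodinger l (g * x) f :=
    (congrArg (fun m : Measure (Heis d) =>
      ∫ x, (leftTranslation g φ) x • schrodinger l x f ∂m) hg.map_eq).symm.trans
      (integral_map hg.measurable.aemeasurable (by rw [hg.map_eq]; exact h1))
  rw [h2]
  refine Eq.trans ?_ ((schrodinger l g).toContinuousLinearMap.integral_comp_comm
    (integrable_smul_schrodinger l hφ f))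
  refine integral_congr_ae ?_
  filter_upwards [hg.quasiMeasurePreserving.ae (coeFn_leftTranslation g φ)] with x hx
  rw [hx, inv_mul_cancel_left, schrodinger_mul, LinearIsometry.coe_toContinuousLinearMap, map_smul]

theorem IsFourierLimit.leftTranslation {ψ : L2Heis d} {H : ℝ → L2Rd d →L[ℂ] L2Rd d}
    (h : IsFourierLimit ψ H) (g : Heis d) :
    IsFourierLimit (leftTranslation g ψ)
      fun l => (schrodinger l g).toContinuousLinearMap ∘L H l := by
  obtain ⟨φ, hφ, h1, h2⟩ := h
  refine ⟨fun n => HeisFrame.leftTranslation g (φ n),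
    fun n => integrable_leftTranslation g (hφ n),
    ((HeisFrame.leftTranslation g).continuous.tendsto ψ).comp h1, ?_⟩
  convert h2 using 2 with n
  simp only [fieldNormSq]
  congr 1 with l
  rw [fourierOp_leftTranslation, ← ContinuousLinearMap.comp_sub, hsNormSq_comp_isometry]

end Translation

section RankOne

variable {d : ℕ}

/-! ### The kernels of the translates -/

/-- The kernel of the field `λ ↦ π_λ(g) H_ε(λ)`. -/
def projKernel (u : L2Rd d) (ε : ℝ) (g : Heis d) (w : ℝ × (Rd d × Rd d)) : ℂ :=
  (Set.Ioc ε 1).indicator 1 w.1 * ((starRingEnd ℂ) (chirp w.2) *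
    ((twist w.1 g w.2.1 * u (w.2.1 - w.1 • g.p)) *
      (starRingEnd ℂ) (Lp.fourierTransformₗᵢ (Rd d) ℂ u w.2.2)))

theorem stronglyMeasurable_projKernel (u : L2Rd d) (ε : ℝ) (g : Heis d) :
    StronglyMeasurable (projKernel u ε g) := by
  have h1 : StronglyMeasurable fun w : ℝ × (Rd d × Rd d) =>
      (Set.Ioc ε 1).indicator (1 : ℝ → ℂ) w.1 :=
    (stronglyMeasurable_one.indicator measurableSet_Ioc).comp_measurable measurable_fst
  have h2 : StronglyMeasurable fun w : ℝ × (Rd d × Rd d) => (starRingEnd ℂ) (chirp w.2) :=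
    (Complex.continuous_conj.comp (continuous_chirp.comp continuous_snd)).stronglyMeasurable
  have h3 : StronglyMeasurable fun w : ℝ × (Rd d × Rd d) => twist w.1 g w.2.1 :=
    (continuous_twist.comp (by fun_prop :
      Continuous fun w : ℝ × (Rd d × Rd d) => (w.1, g, w.2.1))).stronglyMeasurable
  have h4 : StronglyMeasurable fun w : ℝ × (Rd d × Rd d) => u (w.2.1 - w.1 • g.p) :=
    (Lp.stronglyMeasurable u).comp_measurable
      (by fun_prop : Continuous fun w : ℝ × (Rd d × Rd d) => w.2.1 - w.1 • g.p).measurable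
  have h5 : StronglyMeasurable fun w : ℝ × (Rd d × Rd d) =>
      (starRingEnd ℂ) (Lp.fourierTransformₗᵢ (Rd d) ℂ u w.2.2) :=
    Complex.continuous_conj.comp_stronglyMeasurable
      ((Lp.stronglyMeasurable _).comp_measurable (measurable_snd.comp measurable_snd))
  exact h1.mul (h2.mul ((h3.mul h4).mul h5))

theorem norm_dilatedSchrodinger {l : ℝ} (hl : l ≠ 0) (x : Heis d) (v : L2Rd d) :
    ‖dilatedSchrodinger l x v‖ = ‖v‖ := by
  rw [← (dil l).norm_map (dilatedSchrodinger l x v), ← schrodinger_dil hl,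
    LinearIsometry.norm_map, LinearIsometryEquiv.norm_map]

/-- At each `l` in `(ε,1]` the kernel is a unimodular factor times an elementary tensor, of squared
norm `‖u‖⁴`; the Plancherel density is at most `1` on this bounded interval. -/
theorem memLp_projKernel (u : L2Rd d) {ε : ℝ} (hε : 0 < ε) (g : Heis d) :
    MemLp (projKernel u ε g) 2 ((plancherel d).prod volume) := by
  have hm := stronglyMeasurable_projKernel u ε g
  rw [memLp_two_iff_lintegral hm.aestronglyMeasurable,
    lintegral_prod _ (hm.enorm.pow_const 2).aemeasurable]
  have h1 : ∀ l : ℝ, ∫⁻ z, ‖projKernel u ε g (l, z)‖ₑ ^ 2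
      = (Set.Ioc ε 1).indicator (fun _ => ‖u‖ₑ ^ 2 * ‖u‖ₑ ^ 2) l := by
    intro l
    by_cases hl : l ∈ Set.Ioc ε 1
    · rw [Set.indicator_of_mem hl]
      have h2 := lintegral_tensor (memLp_twist_mul l g u).1
        (memLp_conj (Lp.memLp (Lp.fourierTransformₗᵢ (Rd d) ℂ u))).1
      rw [← enorm_toLp_sq (memLp_twist_mul l g u), ← enorm_toLp_sq (memLp_conj (Lp.memLp _))] at h2
      have h3 : ‖(memLp_twist_mul l g u).toLp‖ₑ = ‖u‖ₑ := by
        rw [← ofReal_norm, ← ofReal_norm]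
        exact congrArg _ (norm_dilatedSchrodinger (hε.trans hl.1).ne' g u)
      have h4 : ‖(memLp_conj (Lp.memLp (Lp.fourierTransformₗᵢ (Rd d) ℂ u))).toLp‖ₑ ^ 2
          = ‖u‖ₑ ^ 2 := by
        have h5 : ‖Lp.fourierTransformₗᵢ (Rd d) ℂ u‖ₑ = ‖u‖ₑ := by
          rw [← ofReal_norm, ← ofReal_norm, LinearIsometryEquiv.norm_map]
        rw [enorm_toLp_sq, ← h5, enorm_Lp_sq]
        simp [enorm_eq_nnnorm]
      rw [h3, h4] at h2
      rw [← h2]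
      refine lintegral_congr fun z => ?_
      simp only [projKernel, Set.indicator_of_mem hl, Pi.one_apply, one_mul]
      rw [enorm_mul, ← ofReal_norm ((starRingEnd ℂ) _), RCLike.norm_conj, norm_chirp,
        ENNReal.ofReal_one, one_mul]
    · simp [projKernel, hl]
  simp_rw [h1]
  rw [lintegral_indicator_const measurableSet_Ioc, plancherel]
  refine ENNReal.mul_lt_top (by finiteness) ?_
  rw [withDensity_apply _ measurableSet_Ioc]
  refine (setLIntegral_mono (g := fun _ => (1 : ℝ≥0∞)) measurable_const fun l hl => ?_).trans_lt ?_
  · have h0 : 0 ≤ l := (hε.trans hl.1).le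
    rw [ENNReal.ofReal_le_one, abs_of_nonneg h0]
    exact pow_le_one₀ h0 hl.2
  · simp

theorem projField_of_mem {u : L2Rd d} {ε l : ℝ} (hl : l ∈ Set.Ioc ε 1) :
    projField u ε l = InnerProductSpace.rankOne ℂ (dilate l u) (dilate l u) :=
  if_pos hl

theorem projField_of_notMem {u : L2Rd d} {ε l : ℝ} (hl : l ∉ Set.Ioc ε 1) :
    projField u ε l = 0 :=
  if_neg hl

/-- In the model, `π_l(g)` composed with the projection is still of rank one: it pairs with the
Fourier transform of `u` and returns `dilatedSchrodinger l g u`. The conjugate `chirp` in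
`projKernel` cancels the one built into `HasFieldKernel`. -/
theorem hasFieldKernel_projField (u : L2Rd d) {ε : ℝ} (hε : 0 < ε) (g : Heis d) :
    HasFieldKernel (fun l => (schrodinger l g).toContinuousLinearMap ∘L projField u ε l)
      (projKernel u ε g) := by
  refine Eventually.of_forall fun l => ?_
  intro f h
  by_cases hl : l ∈ Set.Ioc ε 1
  · have hl0 : l ≠ 0 := (hε.trans hl.1).ne'
    rw [inner_model]
    dsimp only
    rw [projField_of_mem hl]
    simp only [ContinuousLinearMap.comp_apply, InnerProductSpace.rankOne_apply,
      LinearIsometry.coe_toContinuousLinearMap, map_smul, inner_smul_right]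
    rw [← dil_apply hl0, schrodinger_dil hl0, LinearIsometryEquiv.inner_map_map,
      LinearIsometryEquiv.inner_map_map, ← (Lp.fourierTransformₗᵢ (Rd d) ℂ).inner_map_map u,
      LinearIsometryEquiv.apply_symm_apply, inner_Lp, inner_Lp, mul_comm, ← integral_prod_mul]
    refine integral_congr_ae ?_
    filter_upwards [Measure.quasiMeasurePreserving_fst.ae (memLp_twist_mul l g u).coeFn_toLp]
      with z hz
    have hc : chirp z * (starRingEnd ℂ) (chirp z) = 1 := by
      rw [Complex.mul_conj', norm_chirp]
      simp
    rw [dilatedSchrodinger, hz, projKernel, Set.indicator_of_mem hl]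
    simp only [Pi.one_apply]
    linear_combination (-(starRingEnd ℂ) (f z.1) * (twist l g z.1 * u (z.1 - l • g.p)) *
      (starRingEnd ℂ) (Lp.fourierTransformₗᵢ (Rd d) ℂ u z.2) * h z.2) * hc
  · rw [inner_model]
    dsimp only
    rw [projField_of_notMem hl]
    simp [projKernel, hl]

/-! ### Existence and uniqueness of `ψ_ε`, and the Gram matrix of its translates -/

theorem projField_eq_translate (u : L2Rd d) (ε : ℝ) :
    (fun l => (schrodinger l 1).toContinuousLinearMap ∘L projField u ε l) = projField u ε := by
  funext l
  ext1 f
  exact schrodinger_one l _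

theorem isL2Field_projField (u : L2Rd d) {ε : ℝ} (hε : 0 < ε) : IsL2Field (projField u ε) := by
  constructor
  · intro f g
    -- The pairing is, for `l ≠ 0`, the integral over `y` of a jointly measurable function of `(l,
    -- y)`, hence measurable in `l`.
    have hd : ∀ h : L2Rd d, AEMeasurable (fun l : ℝ => inner ℂ h (dilate l u)) volume := by
      intro h
      have hm : StronglyMeasurable fun w : ℝ × Rd d => (starRingEnd ℂ) (h w.2) *
          (((|w.1| ^ ((d : ℝ) / 2) : ℝ) : ℂ) * u (w.1 • w.2)) := by
        refine (Complex.continuous_conj.comp_stronglyMeasurable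
          ((Lp.stronglyMeasurable h).comp_measurable measurable_snd)).mul
          (Measurable.stronglyMeasurable ?_ |>.mul
            ((Lp.stronglyMeasurable u).comp_measurable (by fun_prop)))
        fun_prop
      refine (hm.integral_prod_right' (ν := volume)).aestronglyMeasurable.aemeasurable.congr ?_
      filter_upwards [Measure.ae_ne volume (0 : ℝ)] with l hl
      rw [inner_Lp]
      refine integral_congr_ae ?_
      filter_upwards [coeFn_dilate hl u] with y hy
      rw [hy]
    have h1 : AEMeasurable (fun l : ℝ => (Set.Ioc ε 1).indicator
        (fun l => (starRingEnd ℂ) (inner ℂ g (dilate l u)) * inner ℂ f (dilate l u)) l) volume :=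
      ((Complex.continuous_conj.measurable.comp_aemeasurable (hd g)).mul (hd f)).indicator
        measurableSet_Ioc
    refine h1.congr (Eventually.of_forall fun l => ?_)
    by_cases hl : l ∈ Set.Ioc ε 1
    · simp only [Set.indicator_of_mem hl]
      rw [projField_of_mem hl, InnerProductSpace.rankOne_apply, inner_smul_right,
        inner_conj_symm]
    · simp only [Set.indicator_of_notMem hl]
      rw [projField_of_notMem hl]
      simp
  · have h := hasFieldKernel_projField u hε 1
    rw [projField_eq_translate] at h
    rw [fieldNormSq_eq_lintegral h (memLp_projKernel u hε 1)]
    exact (memLp_two_iff_lintegral (memLp_projKernel u hε 1).1).1 (memLp_projKernel u hε 1)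

theorem HasFieldKernel.toLp {H : ℝ → L2Rd d →L[ℂ] L2Rd d} {K : ℝ × (Rd d × Rd d) → ℂ}
    (h : HasFieldKernel H K) (hK : MemLp K 2 ((plancherel d).prod volume)) :
    HasFieldKernel H hK.toLp := by
  filter_upwards [h, ae_of_ae_plancherel (Measure.ae_ae_of_ae_prod hK.coeFn_toLp)] with l h1 h2
  intro f g
  rw [h1 f g]
  refine integral_congr_ae ?_
  filter_upwards [h2] with z hz
  rw [hz]

theorem kernelTransform_leftTranslation {u : L2Rd d} {ε : ℝ} (hε : 0 < ε) {ψ : L2Heis d}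
    (hψ : IsFourierLimit ψ (projField u ε)) (g : Heis d) :
    kernelTransform (leftTranslation g ψ) = (memLp_projKernel u hε g).toLp :=
  (hψ.leftTranslation g).kernelTransform_eq ((hasFieldKernel_projField u hε g).toLp _)

theorem existsUnique_isFourierTransform (u : L2Rd d) {ε : ℝ} (hε : 0 < ε) :
    ∃! ψ : L2Heis d, IsFourierTransform ψ (projField u ε) := by
  have h := (hasFieldKernel_projField u hε 1).toLp (memLp_projKernel u hε 1)
  rw [projField_eq_translate] at h
  obtain ⟨ψ, hψ⟩ := kernelTransform_surjective (memLp_projKernel u hε 1).toLp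
  refine ⟨ψ, ⟨isL2Field_projField u hε, isFourierLimit_of_kernelTransform_eq h hψ⟩, ?_⟩
  intro ψ' hψ'
  refine kernelTransform.injective ?_
  rw [hψ]
  exact IsFourierLimit.kernelTransform_eq hψ'.2 h

/-- The Gram matrix of the translates of `ψ`. -/
theorem inner_leftTranslation {u : L2Rd d} (hu : ‖u‖ = 1) {ε : ℝ} (hε : 0 < ε) {ψ : L2Heis d}
    (hψ : IsFourierLimit ψ (projField u ε)) (g g' : Heis d) :
    inner ℂ (leftTranslation g ψ) (leftTranslation g' ψ)
      = ∫ l in Set.Ioc ε 1, ((l ^ d : ℝ) : ℂ) *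
        inner ℂ (schrodinger l g (dilate l u)) (schrodinger l g' (dilate l u)) := by
  rw [← kernelTransform.inner_map_map, kernelTransform_leftTranslation hε hψ,
    kernelTransform_leftTranslation hε hψ, inner_toLp, integral_prod]
  swap
  · exact (memLp_conj (memLp_projKernel u hε g)).integrable_mul (memLp_projKernel u hε g')
  have h1 : ∀ l : ℝ, ∫ z, (starRingEnd ℂ) (projKernel u ε g (l, z)) * projKernel u ε g' (l, z)
      = (Set.Ioc ε 1).indicator (fun l =>
        inner ℂ (schrodinger l g (dilate l u)) (schrodinger l g' (dilate l u))) l := by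
    intro l
    by_cases hl : l ∈ Set.Ioc ε 1
    · have hl0 : l ≠ 0 := (hε.trans hl.1).ne'
      -- The `ξ`-factor is the same in both kernels, and normalization of `u` makes it integrate to
      -- `1`; only the `y`-factors contribute to the inner product.
      have h2 : ∫ ξ, (starRingEnd ℂ) (Lp.fourierTransformₗᵢ (Rd d) ℂ u ξ)
          * Lp.fourierTransformₗᵢ (Rd d) ℂ u ξ = 1 := by
        rw [← inner_Lp, LinearIsometryEquiv.inner_map_map, inner_self_eq_norm_sq_to_K, hu]
        simp
      rw [Set.indicator_of_mem hl, ← dil_apply hl0, schrodinger_dil hl0, schrodinger_dil hl0,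
        LinearIsometryEquiv.inner_map_map, dilatedSchrodinger, dilatedSchrodinger, inner_toLp]
      refine Eq.trans ?_ (mul_one _)
      rw [← h2, ← integral_prod_mul]
      refine integral_congr_ae (Eventually.of_forall fun z => ?_)
      have hc : chirp z * (starRingEnd ℂ) (chirp z) = 1 := by
        rw [Complex.mul_conj', norm_chirp]
        simp
      simp only [projKernel, Set.indicator_of_mem hl, Pi.one_apply, one_mul, map_mul,
        Complex.conj_conj]
      linear_combination ((starRingEnd ℂ) (twist l g z.1) *
        (starRingEnd ℂ) (u (z.1 - l • g.p)) * (twist l g' z.1 * u (z.1 - l • g'.p)) *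
        (starRingEnd ℂ) (Lp.fourierTransformₗᵢ (Rd d) ℂ u z.2)
          * Lp.fourierTransformₗᵢ (Rd d) ℂ u z.2) * hc
    · simp [projKernel, hl]
  simp_rw [h1]
  rw [plancherel, integral_withDensity_eq_integral_toReal_smul measurable_density
    (Eventually.of_forall fun l => by simp), ← integral_indicator measurableSet_Ioc]
  refine integral_congr_ae (Eventually.of_forall fun l => ?_)
  by_cases hl : l ∈ Set.Ioc ε 1
  · have h0 : 0 ≤ l := (hε.trans hl.1).le
    simp only [Set.indicator_of_mem hl]
    rw [ENNReal.toReal_ofReal (by positivity), abs_of_nonneg h0, Complex.real_smul]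
  · simp [hl]

end RankOne

section Frames

variable {E : Type*} [NormedAddCommGroup E] [InnerProductSpace ℂ E]

/-! ### Frames and dense subspaces -/

/-- Young's inequality with a free weight `δ`, so that the constant in front of `‖x‖ ^ 2` can be
brought arbitrarily close to `1`. -/
theorem norm_add_sq_le_weighted (x y : ℂ) {δ : ℝ} (hδ : 0 < δ) :
    ‖x + y‖ ^ 2 ≤ (1 + δ) * ‖x‖ ^ 2 + (1 + δ⁻¹) * ‖y‖ ^ 2 := by
  have h1 : ‖x + y‖ ^ 2 ≤ (‖x‖ + ‖y‖) ^ 2 := by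
    gcongr
    exact norm_add_le x y
  have h2 : 2 * (‖x‖ * ‖y‖) ≤ δ * ‖x‖ ^ 2 + δ⁻¹ * ‖y‖ ^ 2 := by
    have h3 : 0 ≤ δ⁻¹ * (δ * ‖x‖ - ‖y‖) ^ 2 := by positivity
    have h4 : δ⁻¹ * (δ * ‖x‖ - ‖y‖) ^ 2
        = δ * ‖x‖ ^ 2 + δ⁻¹ * ‖y‖ ^ 2 - 2 * (‖x‖ * ‖y‖) := by
      field_simp
      ring
    linarith
  nlinarith

/-- The frame inequalities pass from a subspace to its closure. -/
theorem frame_bounds_closure {ι : Type*} {v : ι → E} {a b : ℝ} {S : Submodule ℂ E}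
    (h : ∀ φ ∈ S, Summable (fun i => ‖inner ℂ (v i) φ‖ ^ 2) ∧
      a * ‖φ‖ ^ 2 ≤ ∑' i, ‖inner ℂ (v i) φ‖ ^ 2 ∧
      ∑' i, ‖inner ℂ (v i) φ‖ ^ 2 ≤ b * ‖φ‖ ^ 2) :
    ∀ φ ∈ S.topologicalClosure, Summable (fun i => ‖inner ℂ (v i) φ‖ ^ 2) ∧
      a * ‖φ‖ ^ 2 ≤ ∑' i, ‖inner ℂ (v i) φ‖ ^ 2 ∧
      ∑' i, ‖inner ℂ (v i) φ‖ ^ 2 ≤ b * ‖φ‖ ^ 2 := by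
  -- Finite partial sums are continuous in `φ`, so the upper bound extends to the closure and gives
  -- summability there.
  have h1 : ∀ φ ∈ S.topologicalClosure, ∀ s : Finset ι,
      ∑ i ∈ s, ‖inner ℂ (v i) φ‖ ^ 2 ≤ b * ‖φ‖ ^ 2 := by
    intro φ hφ s
    have hc : IsClosed {φ : E | ∑ i ∈ s, ‖inner ℂ (v i) φ‖ ^ 2 ≤ b * ‖φ‖ ^ 2} :=
      isClosed_le (by fun_prop) (by fun_prop)
    refine closure_minimal (fun φ hφ => ?_) hc hφ
    exact ((h φ hφ).1.sum_le_tsum s fun i _ => by positivity).trans (h φ hφ).2.2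
  have h2 : ∀ φ ∈ S.topologicalClosure, Summable (fun i => ‖inner ℂ (v i) φ‖ ^ 2) :=
    fun φ hφ => summable_of_sum_le (fun i => by positivity) (h1 φ hφ)
  have h3 : ∀ φ ∈ S.topologicalClosure, ∑' i, ‖inner ℂ (v i) φ‖ ^ 2 ≤ b * ‖φ‖ ^ 2 :=
    fun φ hφ => (h2 φ hφ).tsum_le_of_sum_le (h1 φ hφ)
  intro φ hφ
  refine ⟨h2 φ hφ, ?_, h3 φ hφ⟩
  obtain ⟨x, hx, hxφ⟩ := mem_closure_iff_seq_limit.1 hφ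
  -- The lower bound involves the whole series. Split `x n = φ + (x n - φ)` with weight `δ`: the
  -- upper bound controls the error series by `‖x n - φ‖ ^ 2`, which vanishes as `n → ∞`; afterwards
  -- `δ → 0`.
  have h4 : ∀ δ > 0, a * ‖φ‖ ^ 2 ≤ (1 + δ) * ∑' i, ‖inner ℂ (v i) φ‖ ^ 2 := by
    intro δ hδ
    have h5 : ∀ n, a * ‖x n‖ ^ 2 ≤ (1 + δ) * ∑' i, ‖inner ℂ (v i) φ‖ ^ 2
        + (1 + δ⁻¹) * (b * ‖x n - φ‖ ^ 2) := by
      intro n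
      have hd : x n - φ ∈ S.topologicalClosure :=
        sub_mem (S.le_topologicalClosure (hx n)) hφ
      refine (h _ (hx n)).2.1.trans ?_
      have h6 : ∑' i, ‖inner ℂ (v i) (x n)‖ ^ 2 ≤ ∑' i, ((1 + δ) * ‖inner ℂ (v i) φ‖ ^ 2
          + (1 + δ⁻¹) * ‖inner ℂ (v i) (x n - φ)‖ ^ 2) := by
        refine (h _ (hx n)).1.tsum_le_tsum (fun i => ?_)
          (((h2 φ hφ).mul_left _).add ((h2 _ hd).mul_left _))
        have h7 := norm_add_sq_le_weighted (inner ℂ (v i) φ) (inner ℂ (v i) (x n - φ)) hδ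
        rwa [← inner_add_right, add_sub_cancel] at h7
      rw [((h2 φ hφ).mul_left _).tsum_add ((h2 _ hd).mul_left _), tsum_mul_left,
        tsum_mul_left] at h6
      refine h6.trans ?_
      gcongr
      exact h3 _ hd
    have h8 : Tendsto (fun n => a * ‖x n‖ ^ 2) atTop (𝓝 (a * ‖φ‖ ^ 2)) :=
      (hxφ.norm.pow 2).const_mul a
    have h9 : Tendsto (fun n => (1 + δ) * ∑' i, ‖inner ℂ (v i) φ‖ ^ 2
        + (1 + δ⁻¹) * (b * ‖x n - φ‖ ^ 2)) atTop
        (𝓝 ((1 + δ) * ∑' i, ‖inner ℂ (v i) φ‖ ^ 2 + (1 + δ⁻¹) * (b * 0 ^ 2))) := by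
      refine tendsto_const_nhds.add (Tendsto.const_mul _ (Tendsto.const_mul _ (Tendsto.pow ?_ 2)))
      exact tendsto_iff_norm_sub_tendsto_zero.1 hxφ
    have h10 := le_of_tendsto_of_tendsto' h8 h9 h5
    simpa using h10
  have h5 : Tendsto (fun δ : ℝ => (1 + δ) * ∑' i, ‖inner ℂ (v i) φ‖ ^ 2) (𝓝[>] 0)
      (𝓝 ((1 + 0) * ∑' i, ‖inner ℂ (v i) φ‖ ^ 2)) :=
    ((by fun_prop : Continuous fun δ : ℝ =>
      (1 + δ) * ∑' i, ‖inner ℂ (v i) φ‖ ^ 2).tendsto 0).mono_left nhdsWithin_le_nhds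
  rw [add_zero, one_mul] at h5
  exact ge_of_tendsto h5 (eventually_nhdsWithin_of_forall h4)

/-! ### Systems whose Gram matrix is a direct sum of Toeplitz matrices -/

/-- `e^{2πi k x}`. -/
def expChar (k : ℤ) (x : ℝ) : ℂ := Complex.exp (2 * Real.pi * Complex.I * k * x)

@[fun_prop] theorem continuous_expChar (k : ℤ) : Continuous (expChar k) := by
  unfold expChar
  fun_prop

theorem conj_expChar (k : ℤ) (x : ℝ) : (starRingEnd ℂ) (expChar k x) = expChar (-k) x := by
  rw [expChar, expChar, ← Complex.exp_conj]
  congr 1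
  simp [Complex.conj_ofNat]

theorem expChar_add (k m : ℤ) (x : ℝ) : expChar (k + m) x = expChar k x * expChar m x := by
  rw [expChar, expChar, expChar, ← Complex.exp_add]
  congr 1
  push_cast
  ring

theorem hasSum_sq_fourier {f : ℝ → ℂ} (hf : MemLp f 2 (volume.restrict (Set.Ioc 0 1))) :
    HasSum (fun m : ℤ => ‖∫ x in Set.Ioc (0 : ℝ) 1, expChar (-m) x * f x‖ ^ 2)
      (∫ x in Set.Ioc (0 : ℝ) 1, ‖f x‖ ^ 2) := by
  have h := hasSum_sq_fourierCoeffOn (zero_lt_one' ℝ) hf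
  simp only [sub_zero, inv_one, one_smul, intervalIntegral.integral_of_le zero_le_one] at h
  convert h using 4 with m
  rw [fourierCoeffOn_eq_integral, intervalIntegral.integral_of_le zero_le_one]
  simp only [sub_zero, div_one, one_smul, smul_eq_mul]
  refine integral_congr_ae (Eventually.of_forall fun x => ?_)
  simp only
  rw [fourier_coe_apply, expChar]
  simp

variable {J : Type*} {v : J × ℤ → E} {w : ℝ → ℝ} {a b : ℝ}

open Classical in
/-- The trigonometric polynomial with the coefficients `c (j, ·)`. -/
def trigPoly (c : J × ℤ →₀ ℂ) (j : J) (x : ℝ) : ℂ :=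
  ∑ q ∈ c.support, if q.1 = j then c q * expChar q.2 x else 0

@[fun_prop] theorem continuous_trigPoly (c : J × ℤ →₀ ℂ) (j : J) :
    Continuous (trigPoly c j) := by
  unfold trigPoly
  refine continuous_finsetSum _ fun q _ => ?_
  split_ifs <;> fun_prop

theorem memLp_weight_mul (hw : Measurable w) (hwb : ∀ x, |w x| ≤ b) {f : ℝ → ℂ}
    (hf : Continuous f) : MemLp (fun x => (w x : ℂ) * f x) 2 (volume.restrict (Set.Ioc 0 1)) := by
  obtain ⟨C, hC⟩ := isCompact_Icc (a := (0 : ℝ)) (b := 1) |>.exists_bound_of_continuousOn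
    hf.continuousOn
  have hb : 0 ≤ b := (abs_nonneg _).trans (hwb 0)
  refine MemLp.of_bound ((by fun_prop : Measurable fun x => (w x : ℂ)).aestronglyMeasurable.mul
    hf.aestronglyMeasurable) (b * C) ?_
  filter_upwards [ae_restrict_mem measurableSet_Ioc] with x hx
  rw [norm_mul, Complex.norm_real, Real.norm_eq_abs]
  exact mul_le_mul (hwb x) (hC x ⟨hx.1.le, hx.2⟩) (norm_nonneg _) hb

theorem integrable_weight_mul (hw : Measurable w) (hwb : ∀ x, |w x| ≤ b) {f : ℝ → ℂ}
    (hf : Continuous f) : Integrable (fun x => (w x : ℂ) * f x) (volume.restrict (Set.Ioc 0 1)) :=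
  (memLp_weight_mul hw hwb hf).integrable (by norm_num)

open Classical in
/-- The Gram matrix of `v` is a direct sum of copies of the Toeplitz matrix with symbol `w`. -/
def HasToeplitzGram (v : J × ℤ → E) (w : ℝ → ℝ) : Prop :=
  ∀ p q : J × ℤ, inner ℂ (v p) (v q) =
    if q.1 = p.1 then ∫ x in Set.Ioc (0 : ℝ) 1, (w x : ℂ) * expChar (q.2 - p.2) x else 0

/-- The frame coefficient at `(j, m)` is the `m`-th Fourier coefficient of `w` times the
trigonometric polynomial of the block `j`, which is what makes Parseval applicable block by block.
-/
theorem inner_finsupp_sum (hv : HasToeplitzGram v w) (hw : Measurable w) (hwb : ∀ x, |w x| ≤ b)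
    (c : J × ℤ →₀ ℂ) (p : J × ℤ) :
    inner ℂ (v p) (c.sum fun i r => r • v i)
      = ∫ x in Set.Ioc (0 : ℝ) 1, (w x : ℂ) * (expChar (-p.2) x * trigPoly c p.1 x) := by
  classical
  have h1 : ∀ x : ℝ, (w x : ℂ) * (expChar (-p.2) x * trigPoly c p.1 x)
      = ∑ q ∈ c.support, (w x : ℂ) *
        (if q.1 = p.1 then c q * expChar (q.2 - p.2) x else 0) := by
    intro x
    rw [trigPoly, Finset.mul_sum, Finset.mul_sum]
    refine Finset.sum_congr rfl fun q _ => ?_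
    split_ifs
    · rw [sub_eq_add_neg, expChar_add]
      ring
    · simp
  simp_rw [h1]
  rw [integral_finsetSum, Finsupp.sum, inner_sum]
  · refine Finset.sum_congr rfl fun q _ => ?_
    rw [inner_smul_right, hv p q]
    split_ifs
    · rw [← integral_const_mul]
      refine integral_congr_ae (Eventually.of_forall fun x => ?_)
      simp only
      ring
    · simp
  · intro q _
    refine integrable_weight_mul hw hwb ?_
    split_ifs <;> fun_prop

theorem norm_sq_finsupp_sum [DecidableEq J] (hv : HasToeplitzGram v w) (hw : Measurable w)
    (hwb : ∀ x, |w x| ≤ b) (c : J × ℤ →₀ ℂ) :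
    ‖c.sum fun i r => r • v i‖ ^ 2
      = ∑ j ∈ c.support.image Prod.fst,
        ∫ x in Set.Ioc (0 : ℝ) 1, w x * ‖trigPoly c j x‖ ^ 2 := by
  have h1 : inner ℂ (c.sum fun i r => r • v i) (c.sum fun i r => r • v i)
      = ∑ j ∈ c.support.image Prod.fst,
        ∫ x in Set.Ioc (0 : ℝ) 1, (w x : ℂ) *
          ((starRingEnd ℂ) (trigPoly c j x) * trigPoly c j x) := by
    have h2 : inner ℂ (c.sum fun i r => r • v i) (c.sum fun i r => r • v i)
        = ∑ p ∈ c.support, (starRingEnd ℂ) (c p) *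
          ∫ x in Set.Ioc (0 : ℝ) 1, (w x : ℂ) * (expChar (-p.2) x * trigPoly c p.1 x) := by
      conv_lhs => rw [Finsupp.sum, sum_inner]
      refine Finset.sum_congr rfl fun p _ => ?_
      rw [inner_smul_left, ← inner_finsupp_sum hv hw hwb c p]
      rfl
    have hi : ∀ p ∈ c.support, Integrable (fun x => (w x : ℂ) *
        ((starRingEnd ℂ) (c p) * (expChar (-p.2) x * trigPoly c p.1 x)))
        (volume.restrict (Set.Ioc 0 1)) :=
      fun p _ => integrable_weight_mul hw hwb (by fun_prop)
    have hi' : ∀ j ∈ c.support.image Prod.fst, Integrable (fun x => (w x : ℂ) *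
        ((starRingEnd ℂ) (trigPoly c j x) * trigPoly c j x))
        (volume.restrict (Set.Ioc 0 1)) :=
      fun j _ => integrable_weight_mul hw hwb
        ((Complex.continuous_conj.comp (continuous_trigPoly c j)).mul (continuous_trigPoly c j))
    rw [h2, ← integral_finsetSum _ hi']
    simp_rw [← integral_const_mul]
    simp_rw [mul_left_comm ((starRingEnd ℂ) (c _)) (w _ : ℂ)]
    rw [← integral_finsetSum _ hi]
    refine integral_congr_ae (Eventually.of_forall fun x => ?_)
    simp only
    rw [← Finset.mul_sum, ← Finset.mul_sum]
    congr 1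
    -- Only the conjugated polynomial is expanded. After the sums over `j` and `p` are exchanged,
    -- each `p` meets the single block `j = p.1`.
    have h3 : ∀ j, (starRingEnd ℂ) (trigPoly c j x) * trigPoly c j x
        = ∑ p ∈ c.support, if p.1 = j then
          (starRingEnd ℂ) (c p) * (expChar (-p.2) x * trigPoly c p.1 x) else 0 := by
      intro j
      conv_lhs => rw [trigPoly, map_sum, Finset.sum_mul]
      refine Finset.sum_congr rfl fun p _ => ?_
      split_ifs with hp
      · rw [map_mul, conj_expChar, hp, mul_assoc]
        rfl
      · simp
    simp_rw [h3]
    rw [Finset.sum_comm]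
    refine Finset.sum_congr rfl fun p hp => ?_
    rw [Finset.sum_ite_eq, if_pos (Finset.mem_image_of_mem _ hp)]
  have h2 : ((‖c.sum fun i r => r • v i‖ ^ 2 : ℝ) : ℂ)
      = ((∑ j ∈ c.support.image Prod.fst,
        ∫ x in Set.Ioc (0 : ℝ) 1, w x * ‖trigPoly c j x‖ ^ 2 : ℝ) : ℂ) := by
    rw [Complex.ofReal_sum, Complex.ofReal_pow]
    refine (inner_self_eq_norm_sq_to_K (𝕜 := ℂ) _).symm.trans (h1.trans ?_)
    refine Finset.sum_congr rfl fun j _ => ?_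
    rw [← integral_complex_ofReal]
    refine integral_congr_ae (Eventually.of_forall fun x => ?_)
    simp only
    rw [Complex.conj_mul']
    push_cast
    rfl
  exact_mod_cast h2

/-- The squared frame coefficients sum to `∑_j ∫ w²|P_j|²`, the squared norm is `∑_j ∫ w|P_j|²`, and
`a w ≤ w² ≤ b w` pointwise. These inequalities are trivial where `w = 0`, so the symbol may vanish
on a set of positive measure. -/
theorem frame_bounds_span (hv : HasToeplitzGram v w) (hw : Measurable w) (ha : 0 ≤ a)
    (hwab : ∀ x, w x = 0 ∨ a ≤ w x ∧ w x ≤ b) (hb : 0 ≤ b) :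
    ∀ φ ∈ Submodule.span ℂ (Set.range v), Summable (fun i => ‖inner ℂ (v i) φ‖ ^ 2) ∧
      a * ‖φ‖ ^ 2 ≤ ∑' i, ‖inner ℂ (v i) φ‖ ^ 2 ∧
      ∑' i, ‖inner ℂ (v i) φ‖ ^ 2 ≤ b * ‖φ‖ ^ 2 := by
  classical
  intro φ hφ
  obtain ⟨c, rfl⟩ := Finsupp.mem_span_range_iff_exists_finsupp.1 hφ
  have hwb : ∀ x, |w x| ≤ b := fun x => by
    rcases hwab x with h | ⟨h, h'⟩
    · simpa [h] using hb
    · rwa [abs_of_nonneg (ha.trans h)]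
  set F : J → ℝ := fun j => ∫ x in Set.Ioc (0 : ℝ) 1, ‖(w x : ℂ) * trigPoly c j x‖ ^ 2 with hF
  have h1 : ∀ j, HasSum (fun m : ℤ =>
      ‖inner ℂ (v (j, m)) (c.sum fun i r => r • v i)‖ ^ 2) (F j) := by
    intro j
    convert hasSum_sq_fourier (memLp_weight_mul hw hwb (continuous_trigPoly c j)) using 4 with m
    rw [inner_finsupp_sum hv hw hwb]
    refine integral_congr_ae (Eventually.of_forall fun x => ?_)
    simp only
    ring
  have h2 : ∀ j ∉ c.support.image Prod.fst, F j = 0 := by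
    intro j hj
    have h3 : ∀ x, trigPoly c j x = 0 := fun x => by
      refine Finset.sum_eq_zero fun q hq => ?_
      rw [if_neg]
      rintro rfl
      exact hj (Finset.mem_image_of_mem _ hq)
    simp [hF, h3]
  have hs : Summable fun i : J × ℤ => ‖inner ℂ (v i) (c.sum fun i r => r • v i)‖ ^ 2 := by
    rw [summable_prod_of_nonneg fun i => by positivity]
    refine ⟨fun j => (h1 j).summable, ?_⟩
    simp_rw [fun j => (h1 j).tsum_eq]
    exact summable_of_ne_finset_zero h2
  have ht : ∑' i : J × ℤ, ‖inner ℂ (v i) (c.sum fun i r => r • v i)‖ ^ 2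
      = ∑ j ∈ c.support.image Prod.fst, F j := by
    rw [hs.tsum_prod]
    simp_rw [fun j => (h1 j).tsum_eq]
    exact tsum_eq_sum h2
  have hi : ∀ j, Integrable (fun x => w x * ‖trigPoly c j x‖ ^ 2)
      (volume.restrict (Set.Ioc 0 1)) := by
    intro j
    have h3 := (integrable_weight_mul hw hwb (f := fun x => ((‖trigPoly c j x‖ ^ 2 : ℝ) : ℂ))
      (by fun_prop)).re
    refine h3.congr (Eventually.of_forall fun x => ?_)
    simp only [← Complex.ofReal_mul]
    exact Complex.ofReal_re _
  have hi' : ∀ j, Integrable (fun x => ‖(w x : ℂ) * trigPoly c j x‖ ^ 2)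
      (volume.restrict (Set.Ioc 0 1)) := fun j =>
    have h3 := memLp_weight_mul hw hwb (continuous_trigPoly c j)
    (memLp_two_iff_integrable_sq_norm h3.1).1 h3
  have hsq : ∀ j x, ‖(w x : ℂ) * trigPoly c j x‖ ^ 2 = w x * (w x * ‖trigPoly c j x‖ ^ 2) := by
    intro j x
    rw [norm_mul, Complex.norm_real, Real.norm_eq_abs, mul_pow, sq_abs]
    ring
  refine ⟨hs, ?_, ?_⟩
  · rw [ht, norm_sq_finsupp_sum hv hw hwb, Finset.mul_sum]
    refine Finset.sum_le_sum fun j _ => ?_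
    rw [← integral_const_mul]
    refine integral_mono ((hi j).const_mul a) (hi' j) fun x => ?_
    simp only [hsq]
    rcases hwab x with h | ⟨h, -⟩
    · simp [h]
    · have := ha.trans h
      gcongr
  · rw [ht, norm_sq_finsupp_sum hv hw hwb, Finset.mul_sum]
    refine Finset.sum_le_sum fun j _ => ?_
    rw [← integral_const_mul]
    refine integral_mono (hi' j) ((hi j).const_mul b) fun x => ?_
    simp only [hsq]
    rcases hwab x with h | ⟨h', h⟩
    · simp [h]
    · have := ha.trans h'
      gcongr

theorem isFrameFor_of_toeplitz {ι : Type*} (e : J × ℤ ≃ ι) {v : ι → E}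
    (hv : HasToeplitzGram (v ∘ e) w) (hw : Measurable w) (ha : 0 < a) (hab : a ≤ b)
    (hwab : ∀ x, w x = 0 ∨ a ≤ w x ∧ w x ≤ b) :
    IsFrameFor v (Submodule.span ℂ (Set.range v)).topologicalClosure := by
  refine ⟨fun i => Submodule.le_topologicalClosure _ (Submodule.subset_span ⟨i, rfl⟩),
    a, b, ha, hab, fun φ hφ => ?_⟩
  have hb : 0 ≤ b := ha.le.trans hab
  have h := frame_bounds_closure (frame_bounds_span hv hw ha.le hwab hb) φ (by
    rwa [e.surjective.range_comp])
  have h1 := e.summable_iff (f := fun i => ‖inner ℂ (v i) φ‖ ^ 2)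
  have h2 := e.tsum_eq fun i => ‖inner ℂ (v i) φ‖ ^ 2
  rw [← h1, ← h2]
  exact h

end Frames

section Main

variable {d : ℕ}

/-! ### The translates along the lattice -/

/-- The lattice `Γ` is the product of `Γ₁` and the central subgroup `ℤ`. -/
def latticeEquiv (A B : GL (Fin d) ℝ) (h : IntegralPair A B) :
    latticeOne A B × ℤ ≃ lattice A B h :=
  Equiv.ofBijective
    (fun z => ⟨Heis.mk (z.1 : Heis d).p (z.1 : Heis d).q (z.2 : ℝ), by
      obtain ⟨⟨x, m, n, rfl⟩, k⟩ := z
      exact ⟨m, n, k, rfl⟩⟩) (by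
    constructor
    · rintro ⟨⟨x, m, n, rfl⟩, k⟩ ⟨⟨x', m', n', rfl⟩, k'⟩ hx
      have hx' := congrArg Subtype.val hx
      have h1 := congrArg Heis.p hx'
      have h2 := congrArg Heis.q hx'
      have h3 := congrArg Heis.t hx'
      simp only [Heis.p_mk, Heis.q_mk, Heis.t_mk] at h1 h2 h3
      have h4 : k = k' := by exact_mod_cast h3
      simp only [h1, h2, h4]
    · rintro ⟨x, m, n, k, rfl⟩
      exact ⟨(⟨Heis.mk (latticePoint A m) (latticePoint B n) 0, m, n, rfl⟩, k), rfl⟩)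

theorem coe_latticeEquiv (A B : GL (Fin d) ℝ) (h : IntegralPair A B)
    (z : latticeOne A B × ℤ) :
    (latticeEquiv A B h z : Heis d) = Heis.mk (z.1 : Heis d).p (z.1 : Heis d).q (z.2 : ℝ) := rfl

/-- The central coordinate acts by a scalar, and an integer one gives a character of period `1` in
`l`. This is the source of the Toeplitz structure. -/
theorem schrodinger_latticeEquiv (A B : GL (Fin d) ℝ) (h : IntegralPair A B)
    (z : latticeOne A B × ℤ) (l : ℝ) (f : L2Rd d) :
    schrodinger l (latticeEquiv A B h z : Heis d) f
      = expChar z.2 l • schrodinger l (z.1 : Heis d) f := by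
  obtain ⟨⟨x, m, n, rfl⟩, k⟩ := z
  rw [coe_latticeEquiv]
  simp only [Heis.p_mk, Heis.q_mk]
  refine Lp.ext ?_
  filter_upwards [coeFn_schrodinger l (Heis.mk (latticePoint A m) (latticePoint B n) (k : ℝ)) f,
    coeFn_schrodinger l (Heis.mk (latticePoint A m) (latticePoint B n) 0) f,
    Lp.coeFn_smul (expChar k l)
      (schrodinger l (Heis.mk (latticePoint A m) (latticePoint B n) 0) f)] with y h1 h2 h3
  rw [h1, h3, Pi.smul_apply, h2, smul_eq_mul, ← mul_assoc]
  congr 1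
  simp only [phase, expChar, Heis.q_mk, Heis.t_mk, ← Complex.exp_add]
  congr 1
  push_cast
  ring

theorem hasToeplitzGram_translates {A B : GL (Fin d) ℝ} (hAB : IntegralPair A B) {u : L2Rd d}
    (hu : ‖u‖ = 1) {ε : ℝ} (hε : 0 < ε)
    (ho : ∀ᵐ α : ℝ, α ∈ Set.Ioc ε 1 →
      Orthonormal ℂ fun γ : latticeOne A B => schrodinger α (γ : Heis d) (dilate α u))
    {ψ : L2Heis d} (hψ : IsFourierLimit ψ (projField u ε)) :
    HasToeplitzGram
      ((fun γ : lattice A B hAB => leftTranslation (γ : Heis d) ψ) ∘ latticeEquiv A B hAB)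
      ((Set.Ioc ε 1).indicator fun x => x ^ d) := by
  classical
  intro p q
  have h1 : ∀ᵐ l ∂(volume.restrict (Set.Ioc ε 1)), ((l ^ d : ℝ) : ℂ) *
      inner ℂ (schrodinger l (latticeEquiv A B hAB p : Heis d) (dilate l u))
        (schrodinger l (latticeEquiv A B hAB q : Heis d) (dilate l u))
      = if q.1 = p.1 then ((l ^ d : ℝ) : ℂ) * expChar (q.2 - p.2) l else 0 := by
    rw [ae_restrict_iff' measurableSet_Ioc]
    filter_upwards [ho] with l hl hl'
    -- Different points of `Γ₁` give orthogonal vectors, so only the product of the two central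
    -- characters survives, on the diagonal blocks.
    rw [schrodinger_latticeEquiv, schrodinger_latticeEquiv, inner_smul_left, inner_smul_right,
      orthonormal_iff_ite.1 (hl hl') p.1 q.1, conj_expChar, sub_eq_neg_add, expChar_add]
    by_cases hpq : p.1 = q.1
    · simp [hpq]
    · simp [hpq, Ne.symm hpq]
  rw [Function.comp_apply, Function.comp_apply, inner_leftTranslation hu hε hψ,
    integral_congr_ae h1]
  split_ifs
  -- Since `(ε,1]` lies in the period `(0,1]`, the integral is a Fourier coefficient of the symbol
  -- extended by zero.
  · rw [← integral_indicator measurableSet_Ioc, ← integral_indicator measurableSet_Ioc]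
    refine integral_congr_ae (Eventually.of_forall fun x => ?_)
    by_cases hx : x ∈ Set.Ioc ε 1
    · simp only [Set.indicator_of_mem hx,
        Set.indicator_of_mem (show x ∈ Set.Ioc (0 : ℝ) 1 from ⟨hε.trans hx.1, hx.2⟩)]
    · simp [Set.indicator, hx]
  · simp

end Main

end HeisFrame

end

theorem theorem5p1 (d : ℕ) (A B : Matrix.GeneralLinearGroup (Fin d) ℝ)
    (hAB : HeisFrame.IntegralPair A B) (u : HeisFrame.L2Rd d) (hu : ‖u‖ = 1)
    (ε : ℝ) (hε : ε ∈ Set.Ioo (0 : ℝ) 1) :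
    (∃! ψ : HeisFrame.L2Heis d, HeisFrame.IsFourierTransform ψ (HeisFrame.projField u ε)) ∧
    ((∀ᵐ α : ℝ, α ∈ Set.Ioc ε 1 →
        Orthonormal ℂ fun γ : HeisFrame.latticeOne A B =>
          HeisFrame.schrodinger α (γ : HeisFrame.Heis d) (HeisFrame.dilate α u)) →
      ∀ ψ : HeisFrame.L2Heis d, HeisFrame.IsFourierTransform ψ (HeisFrame.projField u ε) →
        HeisFrame.IsFrameFor
          (fun γ : HeisFrame.lattice A B hAB =>
            HeisFrame.leftTranslation (γ : HeisFrame.Heis d) ψ)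
          (HeisFrame.cyclicSpace (HeisFrame.lattice A B hAB) ψ)) := by
  refine ⟨HeisFrame.existsUnique_isFourierTransform u hε.1, fun ho ψ hψ => ?_⟩
  -- The frame bounds are `a = ε ^ d` and `b = 1`, which enclose the values of `x ^ d` on `(ε,1]`.
  refine HeisFrame.isFrameFor_of_toeplitz (HeisFrame.latticeEquiv A B hAB)
    (HeisFrame.hasToeplitzGram_translates hAB hu hε.1 ho hψ.2)
    (Measurable.indicator (by fun_prop) measurableSet_Ioc) (pow_pos hε.1 d)
    (pow_le_one₀ hε.1.le hε.2.le) fun x => ?_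
  by_cases hx : x ∈ Set.Ioc ε 1
  · right
    rw [Set.indicator_of_mem hx]
    exact ⟨pow_le_pow_left₀ hε.1.le hx.1.le d, pow_le_one₀ (hε.1.trans hx.1).le hx.2⟩
  · left
    exact Set.indicator_of_notMem hx _
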